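/- Let $r\ge 1$, let $\mathfrak g=\mathfrak{sl}_{r+1}(\mathbb C)$ be the Lie algebra of trace zero complex $(r+1)\times(r+1)$ matrices, $\mathfrak h\subset\mathfrak g$ the subalgebra of diagonal matrices, $\mathfrak n^+\subset\mathfrak g$ the subalgebra of strictly upper triangular matrices, and let $E_{p,q}$ denote the matrix units. For $1\le i\le r$ put $h_i=E_{i,i}-E_{i+1,i+1}\in\mathfrak h$ and $x_i^-=E_{i+1,i}$, and let $\omega_1,\dots,\omega_r\in\mathfrak h^*$ be the fundamental weights, determined by $\omega_i(h_j)=\delta_{ij}$. Let $\mathfrak g[t]=\mathfrak g\otimes\mathbb C[t]$ be the current algebra, with bracket $[x\otimes f,y\otimes g]=[x,y]\otimes fg$. Let $m_1,\dots,m_r$ be non-negative integers and $\lambda=\sum_{i=1}^r m_i\omega_i$. Let $W(\lambda)$ be the Weyl module, that is, the $\mathfrak g[t]$-module generated by an element $w_\lambda$ with defining relations $$(x\otimes f)\,w_\lambda=0,\qquad (h\otimes tf)\,w_\lambda=0,\qquad (h\otimes 1)\,w_\lambda=\lambda(h)\,w_\lambda,\qquad (x_i^-\otimes 1)^{m_i+1}w_\lambda=0$$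 for all $x\in\mathfrak n^+$, $h\in\mathfrak h$, $f\in\mathbb C[t]$ and $1\le i\le r$. Then $W(\lambda)$ is finite-dimensional and $$\dim_{\mathbb C} W(\lambda)=\prod_{i=1}^r\binom{r+1}{i}^{m_i}.$$ -/

import Mathlib

open scoped TensorProduct Polynomial

noncomputable section

namespace CurrentWeyl

/-- The Lie algebra `𝔤 = 𝔰𝔩_{r+1}` of trace zero complex matrices of size `r + 1`. -/
abbrev g (r : ℕ) : Type :=
  LieAlgebra.SpecialLinear.sl (Fin (r + 1)) ℂ

/-- The current algebra `𝔤[t] = 𝔤 ⊗ ℂ[t]`, with bracket `[f ⊗ x, g ⊗ y] = fg ⊗ [x, y]`;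
the scalars `ℂ[t]` are written in the left tensor factor. -/
abbrev Current (r : ℕ) : Type :=
  ℂ[X] ⊗[ℂ] g r

/-- The universal enveloping algebra of the current algebra. -/
abbrev UCurrent (r : ℕ) : Type :=
  UniversalEnvelopingAlgebra ℂ (Current r)

/-- The matrix unit `E_{p,q}`, `p ≠ q`, as an element of `𝔤`. -/
def E (r : ℕ) (p q : Fin (r + 1)) (h : p ≠ q) : g r :=
  LieAlgebra.SpecialLinear.single p q h 1

/-- The Chevalley generator `x_i^- = E_{i+1,i}` of the `i`-th simple root (with `i` from `0`). -/
def xMinus (r : ℕ) (i : Fin r) : g r :=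
  E r i.succ i.castSucc (ne_of_gt Fin.castSucc_lt_succ)

/-- The simple coroot `h_i = E_{i,i} - E_{i+1,i+1}` (with `i` from `0`). -/
def coroot (r : ℕ) (i : Fin r) : g r :=
  LieAlgebra.SpecialLinear.singleSubSingle i.castSucc i.succ 1

/-- The subspace `𝔫⁺` of `𝔤`, spanned by the matrix units strictly above the diagonal. -/
def nPlus (r : ℕ) : Submodule ℂ (g r) :=
  Submodule.span ℂ {x | ∃ (p q : Fin (r + 1)) (h : p < q), x = E r p q h.ne}

/-- The Cartan subalgebra `𝔥` of diagonal matrices in `𝔤`. -/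
def cartan (r : ℕ) : Submodule ℂ (g r) where
  carrier := {x | (x : Matrix (Fin (r + 1)) (Fin (r + 1)) ℂ).IsDiag}
  add_mem' hx hy := Matrix.IsDiag.add hx hy
  zero_mem' := Matrix.isDiag_zero
  smul_mem' c _ hx := Matrix.IsDiag.smul c hx

/-- The fundamental weight `ω_i` (with `i` from `0`): the sum of the first `i + 1` diagonal
entries. It is the basis of `𝔥^*` dual to the simple coroots, see `fundamentalWeight_coroot`. -/
def fundamentalWeight (r : ℕ) (i : Fin r) : Module.Dual ℂ (cartan r) where
  toFun x := ∑ p : Fin (r + 1) with p ≤ i.castSucc,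
    ((x : g r) : Matrix (Fin (r + 1)) (Fin (r + 1)) ℂ) p p
  map_add' x y := by simp [Finset.sum_add_distrib]
  map_smul' c x := by simp [Finset.mul_sum]

theorem coroot_mem_cartan (r : ℕ) (i : Fin r) : coroot r i ∈ cartan r := by
  intro p q h
  have h1 : ∀ k : Fin (r + 1), Matrix.single k k (1 : ℂ) p q = 0 := by
    intro k
    apply Matrix.single_apply_of_ne
    rintro ⟨rfl, rfl⟩
    exact h rfl
  simp [coroot, h1]

theorem fundamentalWeight_coroot (r : ℕ) (i j : Fin r) :
    fundamentalWeight r i ⟨coroot r j, coroot_mem_cartan r j⟩ = if i = j then 1 else 0 := by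
  have h1 : ∀ k p : Fin (r + 1), Matrix.single k k (1 : ℂ) p p = if k = p then 1 else 0 := by
    intro k p
    simp [Matrix.single_apply]
  simp only [fundamentalWeight, coroot, LinearMap.coe_mk, AddHom.coe_mk,
    LieAlgebra.SpecialLinear.val_singleSubSingle, Matrix.sub_apply, h1, Finset.sum_sub_distrib,
    Finset.sum_ite_eq, Finset.mem_filter, Finset.mem_univ, true_and]
  simp only [Fin.le_def, Fin.val_castSucc, Fin.val_succ, Fin.ext_iff]
  split_ifs <;> first | omega | simp

/-- The dominant integral weight `λ = ∑ m_i ω_i`. -/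
def weight {r : ℕ} (m : Fin r → ℕ) : Module.Dual ℂ (cartan r) :=
  ∑ i, m i • fundamentalWeight r i

/-- The element `f ⊗ x` of `𝔤[t]` inside the enveloping algebra. -/
def cur {r : ℕ} (f : ℂ[X]) (x : g r) : UCurrent r :=
  UniversalEnvelopingAlgebra.ι ℂ (f ⊗ₜ[ℂ] x)

/-- `Relator m u`: the relation `u w_λ = 0` is one of the defining relations of `W(λ)`,
where `λ = ∑ m_i ω_i`. -/
inductive Relator {r : ℕ} (m : Fin r → ℕ) : UCurrent r → Prop
  /-- `𝔫⁺[t] w_λ = 0`. -/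
  | raising (f : ℂ[X]) (x : g r) (hx : x ∈ nPlus r) : Relator m (cur f x)
  /-- `𝔥 t[t] w_λ = 0`. -/
  | cartanPos (f : ℂ[X]) (h : cartan r) : Relator m (cur (Polynomial.X * f) (h : g r))
  /-- `h w_λ = λ(h) w_λ`. -/
  | cartanZero (h : cartan r) :
      Relator m (cur 1 (h : g r) - algebraMap ℂ (UCurrent r) (weight m h))
  /-- `(x_i^- ⊗ 1)^{m_i + 1} w_λ = 0`. -/
  | lowering (i : Fin r) : Relator m (cur 1 (xMinus r i) ^ (m i + 1))

/-- The left ideal of `U(𝔤[t])` generated by the relators. -/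
def relations {r : ℕ} (m : Fin r → ℕ) : Submodule (UCurrent r) (UCurrent r) :=
  Submodule.span (UCurrent r) {u | Relator m u}

/-- The Weyl module `W(λ)`, `λ = ∑ m_i ω_i`: the cyclic `𝔤[t]`-module with generator `w_λ`
(the class of `1`) and the defining relations above. -/
abbrev WeylModule {r : ℕ} (m : Fin r → ℕ) : Type :=
  UCurrent r ⧸ relations m

end CurrentWeyl

end

open scoped TensorProduct Polynomial

noncomputable section

namespace CurrentWeyl

/-! The dimension is bounded from above by induction on the rank and from below by a fusion product.

Upper bound (`rank_span_singleton_le`). Let `w` be a highest weight vector for the current algebra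
of `𝔤𝔩_{r+2}`, killed by the diagonal elements of positive degree. The monomials `lowVec φ w s` in
the degree zero lowering operators of the last row generate the whole module over the current
algebra of the upper left block `𝔤𝔩_{r+1}` (`mem_of_lowVec_mem`). Order them by `ht`. Modulo the
submodule generated by lower monomials, `lowVec φ w s` is killed by the raising operators of the
block (`raising_smul_mem`), and the diagonal elements of positive degree, read as power sums, act on
it through a quotient of the cohomology ring of the product of the Grassmannians of `s i`-planes in
`m i`-space (`boxIdeal_smul_mem`). The complete relations come from Garland's identities, the
elementary ones from the number of factors in the monomial. A chain of ideals with `∏ i, (m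
i).choose (s i)` steps (`reach_boxIdeal`) splits the layer into that many pieces, each generated by
a highest weight vector of the block of weight `m_i - s_i + s_{i+1}`. The induction hypothesis
bounds each piece, and the sum over `s` is Pascal's rule combined with the binomial theorem
(`sum_box_eq_prod`).

Lower bound (`card_le_finrank`). For each `i`, take `m i` copies of the `i`-th fundamental
representation, an exterior power, realised by minors of a matrix of variables. Let the current
algebra act over `ℂ[ε]` on the factor `j` by evaluation at `ε z_j` with distinct `z_j`, and let `L`
be the `ℂ[ε]`-lattice generated from the product `v` of the highest weight vectors. The defining
relators of `W(λ)` send `v` into `ε L` (`relator_fusionGen`), so `L` is generated modulo `ε` by `dim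
W(λ)` elements. By interpolation in the points, every product of minors lies in `L` after
multiplication by a power of `ε` (`exists_X_pow_smul_minorProd_columns`). Nakayama's lemma then
bounds the number of these products, which is the product of binomial coefficients, by `dim W(λ)`.
-/

open scoped IsMulCommutative in
/-- Pairwise commuting elements of an algebra are the values of the variables under an algebra
homomorphism from a polynomial ring. -/
theorem exists_algHom_of_commute {σ A : Type*} [Ring A] [Algebra ℂ A] (f : σ → A)
    (hf : ∀ i j, Commute (f i) (f j)) :
    ∃ φ : MvPolynomial σ ℂ →ₐ[ℂ] A, ∀ i, φ (MvPolynomial.X i) = f i := by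
  have hc : ∀ a ∈ Set.range f, ∀ b ∈ Set.range f, a * b = b * a := by
    rintro _ ⟨i, rfl⟩ _ ⟨j, rfl⟩
    exact hf i j
  have : IsMulCommutative (Algebra.adjoin ℂ (Set.range f)) := Algebra.isMulCommutative_adjoin ℂ hc
  let f' : σ → Algebra.adjoin ℂ (Set.range f) :=
    fun i => ⟨f i, Algebra.subset_adjoin ⟨i, rfl⟩⟩
  refine ⟨(Algebra.adjoin ℂ (Set.range f)).val.comp (MvPolynomial.aeval f'), fun i => ?_⟩
  simp [f']

/-! ### Newton's identities, also with noncommuting power sums. -/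

/-- The sequence determined by Newton's identities from the power sums `p 0, p 1, …` (where `p k`
has degree `k + 1`). For `p` it consists of the complete symmetric functions, for `-p` of the
elementary symmetric functions with signs. -/
def newton {D : Type*} [Ring D] [Algebra ℂ D] (p : ℕ → D) : ℕ → D
  | 0 => 1
  | k + 1 => ((k : ℂ) + 1)⁻¹ • ∑ i : Fin (k + 1), p i * newton p (k - i)

section newton

variable {D : Type*} [Ring D] [Algebra ℂ D] (p : ℕ → D)

theorem newton_zero : newton p 0 = 1 := by rw [newton]

theorem newton_succ (k : ℕ) :
    ((k : ℂ) + 1) • newton p (k + 1) = ∑ i ∈ Finset.range (k + 1), p i * newton p (k - i) := by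
  rw [newton, smul_smul, mul_inv_cancel₀ (Nat.cast_add_one_ne_zero k), one_smul,
    Finset.sum_range]

theorem map_newton {A : Type*} [Ring A] [Algebra ℂ A] (φ : D →ₐ[ℂ] A) (k : ℕ) :
    φ (newton p k) = newton (fun i => φ (p i)) k := by
  induction k using Nat.strong_induction_on with
  | _ k ih =>
    cases k with
    | zero => simp [newton_zero]
    | succ k =>
      rw [newton, newton, map_smul, map_sum]
      congr 1
      refine Finset.sum_congr rfl fun i _ => ?_
      rw [map_mul, ih _ (by omega)]

theorem newton_mem (B : Subalgebra ℂ D) (hp : ∀ i, p i ∈ B) (k : ℕ) : newton p k ∈ B := by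
  have := map_newton (fun i => (⟨p i, hp i⟩ : B)) B.val k
  simp only [Subalgebra.coe_val] at this
  rw [← this]
  exact SetLike.coe_mem _

theorem commute_newton {z : D} (hz : ∀ i, Commute z (p i)) (k : ℕ) : Commute z (newton p k) := by
  have := newton_mem p (Subalgebra.centralizer ℂ {z}) (fun i => by
    rw [Subalgebra.mem_centralizer_iff]
    rintro _ rfl
    exact hz i) k
  rw [Subalgebra.mem_centralizer_iff] at this
  exact this z rfl

/-- If `y` is shifted by the power sums then the first-order difference rule holds. -/
theorem newton_mul_of_shift (y : ℕ → D) (hy : ∀ k b, p k * y b = y b * p k - y (b + k + 1))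
    (k b : ℕ) : newton p (k + 1) * y b = y b * newton p (k + 1) - y (b + 1) * newton p k := by
  induction k using Nat.strong_induction_on generalizing b with
  | _ k ih =>
    have hk : ((k : ℂ) + 1) ≠ 0 := Nat.cast_add_one_ne_zero k
    have key : ∑ i ∈ Finset.range k, p i * newton p (k - i) * y b =
        ∑ i ∈ Finset.range k, (p i * y b * newton p (k - i) -
          p i * y (b + 1) * newton p (k - 1 - i)) := by
      refine Finset.sum_congr rfl fun i hi => ?_
      rw [Finset.mem_range] at hi
      obtain ⟨j, rfl⟩ : ∃ j, k = i + (j + 1) := ⟨k - i - 1, by omega⟩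
      rw [mul_assoc, show i + (j + 1) - i = j + 1 by omega,
        show i + (j + 1) - 1 - i = j by omega, ih j (by omega)]
      noncomm_ring
    have e1 : ((k : ℂ) + 1) • (newton p (k + 1) * y b) =
        (∑ i ∈ Finset.range k, (p i * y b * newton p (k - i) -
          p i * y (b + 1) * newton p (k - 1 - i))) + p k * y b := by
      rw [← smul_mul_assoc, newton_succ, Finset.sum_mul, Finset.sum_range_succ, key]
      simp [newton_zero]
    have e2 : ((k : ℂ) + 1) • (y b * newton p (k + 1)) =
        (∑ i ∈ Finset.range k, y b * (p i * newton p (k - i))) + y b * p k := by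
      rw [← mul_smul_comm, newton_succ, Finset.mul_sum, Finset.sum_range_succ]
      simp [newton_zero]
    have e3 : ((k : ℂ) + 1) • (y (b + 1) * newton p k) =
        (∑ i ∈ Finset.range k, y (b + 1) * (p i * newton p (k - 1 - i))) +
          y (b + 1) * newton p k := by
      rw [add_smul, one_smul]
      congr 1
      cases k with
      | zero => simp
      | succ k =>
        rw [← mul_smul_comm]
        push_cast
        rw [newton_succ, Finset.mul_sum]
    -- One sum over `range (k + 1)`, with its last term split off on the left and its first term on
    -- the right.
    have tel : ∑ i ∈ Finset.range k, y (b + i + 1) * newton p (k - i) + y (b + k + 1) =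
        y (b + 1) * newton p k + ∑ i ∈ Finset.range k, y (b + 1 + i + 1) * newton p (k - 1 - i) := by
      have := Finset.sum_range_succ' (fun i => y (b + i + 1) * newton p (k - i)) k
      rw [Finset.sum_range_succ] at this
      simp only [Nat.sub_self, newton_zero, mul_one, add_zero, Nat.sub_zero] at this
      rw [this, add_comm]
      congr 1
      refine Finset.sum_congr rfl fun i _ => ?_
      rw [show b + (i + 1) + 1 = b + 1 + i + 1 by omega, show k - (i + 1) = k - 1 - i by omega]
    refine smul_right_injective D hk ?_
    simp only [smul_sub]
    rw [e1, e2, e3]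
    simp only [hy, sub_mul, Finset.sum_sub_distrib, mul_assoc]
    rw [← sub_eq_zero] at tel ⊢
    rw [← neg_eq_zero, ← tel]
    abel

end newton

section newtonComm

variable {D : Type*} [CommRing D] [Algebra ℂ D] (p : ℕ → D)

theorem derivative_mk_newton :
    PowerSeries.derivative D (PowerSeries.mk (newton p)) =
      PowerSeries.mk p * PowerSeries.mk (newton p) := by
  ext k
  have := newton_succ p k
  rw [PowerSeries.coeff_derivative, PowerSeries.coeff_mk, PowerSeries.coeff_mul,
    Finset.Nat.sum_antidiagonal_eq_sum_range_succ_mk]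
  simp only [PowerSeries.coeff_mk]
  rw [← this, Algebra.smul_def]
  simp [mul_comm]

/-- With `H` and `E` the series of `p` and `-p`, the equations `H' = P H` and `E' = -P E` give `(E
H)' = 0`, and the constant term is `1`. -/
theorem mk_newton_neg_mul :
    PowerSeries.mk (newton fun k => -p k) * PowerSeries.mk (newton p) = 1 := by
  -- Recovering a series from its derivative requires division by integers, available because `D` is
  -- a `ℂ`-algebra.
  have : Module ℚ D := Module.compHom D (algebraMap ℚ ℂ)
  have : IsAddTorsionFree D := IsAddTorsionFree.of_module_rat D
  apply PowerSeries.derivative.ext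
  · rw [Derivation.leibniz, derivative_mk_newton, derivative_mk_newton]
    have : PowerSeries.mk (fun k => -p k) = -PowerSeries.mk p := by ext; simp
    rw [this, Derivation.map_one_eq_zero]
    simp only [smul_eq_mul]
    ring
  · simp [newton_zero]

theorem sum_newton_neg_mul_newton {k : ℕ} (hk : k ≠ 0) :
    ∑ x ∈ Finset.HasAntidiagonal.antidiagonal k, newton (fun k => -p k) x.1 * newton p x.2 = 0 := by
  have := congrArg (PowerSeries.coeff k) (mk_newton_neg_mul p)
  simpa [PowerSeries.coeff_mul, PowerSeries.coeff_one, hk] using this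

theorem powerSum_mem_of_newton_mem (I : Ideal D) (hI : ∀ k, newton p (k + 1) ∈ I) (k : ℕ) :
    p k ∈ I := by
  have := newton_succ p k
  rw [Finset.sum_range_succ, Nat.sub_self, newton_zero, mul_one] at this
  rw [← sub_eq_iff_eq_add'.mpr this]
  refine I.sub_mem (Submodule.smul_of_tower_mem _ _ (hI k)) (I.sum_mem fun i hi => ?_)
  rw [Finset.mem_range] at hi
  obtain ⟨j, hj⟩ : ∃ j, k - i = j + 1 := ⟨k - i - 1, by omega⟩
  rw [hj]
  exact I.mul_mem_left _ (hI j)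

theorem newton_mem_of_newton_neg_mem (I : Ideal D)
    (hI : ∀ k, newton (fun k => -p k) (k + 1) ∈ I) (k : ℕ) : newton p (k + 1) ∈ I := by
  have := sum_newton_neg_mul_newton p (Nat.succ_ne_zero k)
  rw [Finset.Nat.sum_antidiagonal_eq_sum_range_succ_mk, Finset.sum_range_succ'] at this
  simp only [newton_zero, one_mul, Nat.sub_zero] at this
  rw [eq_neg_of_add_eq_zero_right this]
  exact I.neg_mem (I.sum_mem fun i _ => I.mul_mem_right _ (hI i))

end newtonComm

/-! ### Length bounds for quotients of the ring of power sums. -/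

/-- `Reach p I K`: the ideal `I` can be enlarged to the whole ring by successively adjoining `K`
elements, each of which is multiplied into the ideal already reached by all `p i`. -/
inductive Reach {D ι : Type*} [CommRing D] (p : ι → D) : Ideal D → ℕ → Prop
  | top : Reach p ⊤ 0
  | step (I : Ideal D) (b : D) (K : ℕ) (hb : ∀ i, p i * b ∈ I)
      (h : Reach p (I ⊔ Ideal.span {b}) K) : Reach p I (K + 1)

/-- Multiplication by `c` carries a chain from `J` to the whole ring into a chain from `I` to `I +
(c)`, which is then continued. This is subadditivity of length for `D/J → D/I → D/(I + (c)) → 0`. -/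
theorem Reach.add {D ι : Type*} [CommRing D] {p : ι → D} {J : Ideal D} {K₁ : ℕ}
    (hJ : Reach p J K₁) {I : Ideal D} {c : D} (hc : ∀ x ∈ J, c * x ∈ I) {K₂ : ℕ}
    (hI : Reach p (I ⊔ Ideal.span {c}) K₂) : Reach p I (K₂ + K₁) := by
  induction hJ generalizing I with
  | top =>
    have : c ∈ I := by simpa using hc 1 trivial
    rwa [sup_eq_left.mpr ((Ideal.span_singleton_le_iff_mem I).mpr this)] at hI
  | step J b K hb _ ih =>
    refine Reach.step I (c * b) (K₂ + K) (fun i => ?_) (ih (fun x hx => ?_) ?_)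
    · rw [mul_left_comm]
      exact hc _ (hb i)
    · obtain ⟨y, hy, z, hz, rfl⟩ := Submodule.mem_sup.mp hx
      obtain ⟨a, rfl⟩ := Ideal.mem_span_singleton'.mp hz
      rw [mul_add]
      refine add_mem (Ideal.mem_sup_left (hc y hy)) (Ideal.mem_sup_right ?_)
      exact Ideal.mem_span_singleton'.mpr ⟨a, by ring⟩
    · have hle : Ideal.span {c * b} ≤ Ideal.span {c} := by
        rw [Ideal.span_singleton_le_iff_mem]
        exact Ideal.mem_span_singleton'.mpr ⟨b, mul_comm _ _⟩
      rwa [sup_assoc, sup_eq_right.mpr hle]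

/-- The polynomial ring in the power sums of `n` alphabets; the variable `(i, k)` is the power sum
of degree `k + 1` in the `i`-th alphabet. -/
abbrev PowerSums (n : ℕ) : Type := MvPolynomial (Fin n × ℕ) ℂ

/-- The power sum of degree `k + 1` in the `i`-th alphabet. -/
def psum {n : ℕ} (i : Fin n) (k : ℕ) : PowerSums n := MvPolynomial.X (i, k)

/-- The generators of the ideal of relations between symmetric functions in alphabets of sizes
`s i`, in the cohomology of the product of the Grassmannians of `s i`-planes in `m i`-space. -/
inductive BoxRel {n : ℕ} (m s : Fin n → ℕ) : PowerSums n → Prop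
  | complete (i : Fin n) (k : ℕ) (h : m i < k + s i) : BoxRel m s (newton (psum i) k)
  | elementary (i : Fin n) (k : ℕ) (h : s i < k) : BoxRel m s (newton (fun j => -psum i j) k)

/-- The ideal generated by the elements satisfying `BoxRel`. -/
def boxIdeal {n : ℕ} (m s : Fin n → ℕ) : Ideal (PowerSums n) := Ideal.span {q | BoxRel m s q}

variable {n : ℕ} {m s : Fin n → ℕ}

theorem complete_mem_boxIdeal (i : Fin n) (k : ℕ) (h : m i < k + s i) :
    newton (psum i) k ∈ boxIdeal m s :=
  Ideal.subset_span (BoxRel.complete i k h)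

theorem elementary_mem_boxIdeal (i : Fin n) (k : ℕ) (h : s i < k) :
    newton (fun j => -psum i j) k ∈ boxIdeal m s :=
  Ideal.subset_span (BoxRel.elementary i k h)

theorem boxIdeal_le_iff {I : Ideal (PowerSums n)} :
    boxIdeal m s ≤ I ↔ (∀ i k, m i < k + s i → newton (psum i) k ∈ I) ∧
      ∀ i k, s i < k → newton (fun j => -psum i j) k ∈ I := by
  rw [boxIdeal, Ideal.span_le]
  constructor
  · exact fun h => ⟨fun i k hk => h (.complete i k hk), fun i k hk => h (.elementary i k hk)⟩
  · rintro ⟨h₁, h₂⟩ _ (⟨i, k, hk⟩ | ⟨i, k, hk⟩)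
    · exact h₁ i k hk
    · exact h₂ i k hk

theorem boxIdeal_eq_top (i : Fin n) (h : m i < s i) : boxIdeal m s = ⊤ := by
  rw [Ideal.eq_top_iff_one, ← newton_zero (psum i)]
  exact complete_mem_boxIdeal i 0 (by omega)

/-- Pascal's rule on the level of ideals. With `m i = a + 1` and `s i = b + 1`, let `c` be the
complete function of degree `a - b`. Adjoining `c` replaces `m i` by `a`, and the ideal with `(m i,
s i)` replaced by `(a, b)` is multiplied into `boxIdeal m s` by `c`; `Reach.add` adds the two
counts. -/
theorem reach_boxIdeal (m s : Fin n → ℕ) :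
    Reach (fun x : Fin n × ℕ => psum x.1 x.2) (boxIdeal m s) (∏ i, (m i).choose (s i)) := by
  induction hN : ∑ i, m i using Nat.strong_induction_on generalizing m s with
  | _ N ih =>
    subst hN
    by_cases hlt : ∃ i, m i < s i
    · obtain ⟨i, hi⟩ := hlt
      rw [boxIdeal_eq_top i hi, Finset.prod_eq_zero (Finset.mem_univ i)
        (Nat.choose_eq_zero_of_lt hi)]
      exact Reach.top
    push Not at hlt
    by_cases hm : ∃ i, m i ≠ 0
    · obtain ⟨i, hi⟩ := hm
      obtain ⟨a, ha⟩ := Nat.exists_eq_succ_of_ne_zero hi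
      have hsum : ∑ j, Function.update m i a j < ∑ j, m j := by
        refine Finset.sum_lt_sum (fun j _ => ?_) ⟨i, Finset.mem_univ i, by simp [ha]⟩
        by_cases hj : j = i
        · subst hj; simp [ha]
        · simp [hj]
      have hprod : ∀ (m s : Fin n → ℕ), ∏ j, (m j).choose (s j) =
          (m i).choose (s i) * ∏ j ∈ Finset.univ.erase i, (m j).choose (s j) := fun m s =>
        (Finset.mul_prod_erase _ _ (Finset.mem_univ i)).symm
      have hne : ∀ (f : Fin n → ℕ) (b : ℕ), ∀ j ∈ Finset.univ.erase i,
          Function.update f i b j = f j := fun f b j hj =>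
        Function.update_of_ne (Finset.ne_of_mem_erase hj) _ _
      have hP : ∏ j ∈ Finset.univ.erase i, (Function.update m i a j).choose (s j) =
          ∏ j ∈ Finset.univ.erase i, (m j).choose (s j) :=
        Finset.prod_congr rfl fun j hj => by rw [hne m a j hj]
      by_cases hs : s i = 0
      -- For an empty alphabet all elementary, hence all complete functions of positive degree lie
      -- in the ideal, whatever `m i` is.
      · have hI : boxIdeal m s = boxIdeal (Function.update m i a) s := by
          have hh : ∀ m : Fin n → ℕ, ∀ k, newton (psum i) (k + 1) ∈ boxIdeal m s := fun m =>
            newton_mem_of_newton_neg_mem _ _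
              fun k => elementary_mem_boxIdeal i _ (by omega)
          have : ∀ m m' : Fin n → ℕ, (∀ j, j ≠ i → m j = m' j) →
              boxIdeal m s ≤ boxIdeal m' s := by
            intro m m' hmm
            refine boxIdeal_le_iff.mpr ⟨fun j k hk => ?_, fun j k => elementary_mem_boxIdeal j k⟩
            by_cases hj : j = i
            · subst hj
              obtain ⟨k, rfl⟩ : ∃ l, k = l + 1 := ⟨k - 1, by omega⟩
              exact hh m' k
            · exact complete_mem_boxIdeal j k (by rwa [← hmm j hj])
          exact le_antisymm (this _ _ fun j hj => by simp [hj]) (this _ _ fun j hj => by simp [hj])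
        have := ih _ hsum (Function.update m i a) s rfl
        rw [hI]
        convert this using 1
        rw [hprod, hprod (Function.update m i a), hP, hs]
        simp
      · obtain ⟨b, hb⟩ := Nat.exists_eq_succ_of_ne_zero hs
        have h1 := ih _ hsum (Function.update m i a) s rfl
        have h2 := ih _ hsum (Function.update m i a) (Function.update s i b) rfl
        have hba : b ≤ a := by have := hlt i; omega
        have hcount : ∏ j, (m j).choose (s j) =
            ∏ j, (Function.update m i a j).choose (s j) +
              ∏ j, (Function.update m i a j).choose (Function.update s i b j) := by
          have hP' : ∏ j ∈ Finset.univ.erase i,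
              (Function.update m i a j).choose (Function.update s i b j) =
                ∏ j ∈ Finset.univ.erase i, (m j).choose (s j) :=
            Finset.prod_congr rfl fun j hj => by rw [hne m a j hj, hne s b j hj]
          rw [hprod, hprod (Function.update m i a) s, hprod (Function.update m i a), hP, hP',
            ← add_mul]
          congr 1
          simp only [Function.update_self]
          rw [ha, hb, Nat.choose_succ_succ, add_comm]
        rw [hcount]
        -- In the relation of degree `a + 1` between elementary and complete functions, every other
        -- term contains a generator: a complete function of degree above `a - b` or an elementary
        -- one of degree above `b + 1`.
        have hprodmem : newton (psum i) (a - b) * newton (fun j => -psum i j) (b + 1) ∈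
            boxIdeal m s := by
          have hsum := sum_newton_neg_mul_newton (psum i) (k := a + 1) (by omega)
          rw [Finset.Nat.sum_antidiagonal_eq_sum_range_succ_mk, ← Finset.add_sum_erase _ _
            (a := b + 1) (by simp; omega)] at hsum
          rw [mul_comm, show a - b = a + 1 - (b + 1) by omega, eq_neg_of_add_eq_zero_left hsum]
          refine neg_mem (sum_mem fun j hj => ?_)
          rw [Finset.mem_erase, Finset.mem_range] at hj
          rcases lt_or_gt_of_ne hj.1 with h | h
          · exact Ideal.mul_mem_left _ _ (complete_mem_boxIdeal i _ (by simp; omega))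
          · exact Ideal.mul_mem_right _ _ (elementary_mem_boxIdeal i _ (by simp; omega))
        refine Reach.add (c := newton (psum i) (a - b)) h2 (fun x hx => ?_) ?_
        · have : boxIdeal (Function.update m i a) (Function.update s i b) ≤
              (boxIdeal m s).colon {newton (psum i) (a - b)} := by
            refine boxIdeal_le_iff.mpr ⟨fun j k hk => ?_, fun j k hk => ?_⟩ <;>
              rw [Submodule.mem_colon_singleton, smul_eq_mul]
            · refine Ideal.mul_mem_right _ _ (complete_mem_boxIdeal j _ ?_)
              by_cases hj : j = i
              · subst hj; simp at hk; omega
              · simpa [hj] using hk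
            · by_cases hj : j = i
              · subst hj
                simp at hk
                rcases eq_or_lt_of_le (Nat.succ_le_of_lt hk) with h | h
                · rw [← h, mul_comm]; exact hprodmem
                · exact Ideal.mul_mem_right _ _ (elementary_mem_boxIdeal j _ (by omega))
              · exact Ideal.mul_mem_right _ _ (elementary_mem_boxIdeal j _ (by simpa [hj] using hk))
          have := this hx
          rwa [Submodule.mem_colon_singleton, smul_eq_mul, mul_comm] at this
        · convert h1 using 1
          apply le_antisymm
          · refine sup_le (boxIdeal_le_iff.mpr ⟨fun j k hk => ?_, fun j k =>
              elementary_mem_boxIdeal j k⟩) ?_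
            · refine complete_mem_boxIdeal j k (lt_of_le_of_lt ?_ hk)
              by_cases hj : j = i
              · subst hj; simp [ha]
              · simp [hj]
            · rw [Ideal.span_singleton_le_iff_mem]
              exact complete_mem_boxIdeal i _ (by simp; omega)
          · refine boxIdeal_le_iff.mpr ⟨fun j k hk => ?_, fun j k hk =>
              Ideal.mem_sup_left (elementary_mem_boxIdeal j k hk)⟩
            by_cases hj : j = i
            · subst hj
              simp at hk
              rcases eq_or_ne k (a - b) with h | h
              · subst h
                exact Ideal.mem_sup_right (Ideal.mem_span_singleton_self _)
              · exact Ideal.mem_sup_left (complete_mem_boxIdeal j k (by omega))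
            · exact Ideal.mem_sup_left (complete_mem_boxIdeal j k (by simpa [hj] using hk))
    · push Not at hm
      have hs : ∀ i, s i = 0 := fun i => by have := hlt i; have := hm i; omega
      have hp : ∀ i k, psum i k ∈ boxIdeal m s := fun i =>
        powerSum_mem_of_newton_mem _ _ fun k => complete_mem_boxIdeal i _ (by have := hm i; omega)
      simp only [hm, hs, Nat.choose_self, Finset.prod_const_one]
      refine Reach.step _ 1 0 (fun x => by simpa using hp x.1 x.2) ?_
      rw [Ideal.span_singleton_one, sup_top_eq]
      exact Reach.top

/-! ### Current algebra relations and Garland's identities for a highest weight vector. -/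

/-- The elements `e p q a` satisfy the commutation relations of the elements `E_{p,q} ⊗ t^a` of the
current algebra of `𝔤𝔩_n`. -/
def IsCurrentGL {n : ℕ} {A : Type*} [Ring A] (e : Fin n → Fin n → ℕ → A) : Prop :=
  ∀ p q p' q' a b, e p q a * e p' q' b = e p' q' b * e p q a +
    ((if q = p' then e p q' (a + b) else 0) - if q' = p then e p' q (a + b) else 0)

/-- `w` is a highest weight vector of weight `c` which is killed by the diagonal elements of
positive degree. -/
structure IsHighestWeight {n : ℕ} {A M : Type*} [Ring A] [AddCommGroup M] [Module ℂ M]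
    [Module A M] (e : Fin n → Fin n → ℕ → A) (c : Fin n → ℂ) (w : M) : Prop where
  raising : ∀ p q a, p < q → e p q a • w = 0
  cartan_pos : ∀ p a, e p p (a + 1) • w = 0
  cartan_zero : ∀ p, e p p 0 • w = c p • w

theorem IsCurrentGL.commute {n : ℕ} {A : Type*} [Ring A] {e : Fin n → Fin n → ℕ → A}
    (he : IsCurrentGL e) {p q p' q' : Fin n} (h : q ≠ p') (h' : q' ≠ p) (a b : ℕ) :
    Commute (e p q a) (e p' q' b) := by
  have := he p q p' q' a b
  rwa [if_neg h, if_neg h', sub_zero, add_zero] at this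

theorem IsCurrentGL.commute_diag {n : ℕ} {A : Type*} [Ring A] {e : Fin n → Fin n → ℕ → A}
    (he : IsCurrentGL e) (p q : Fin n) (a b : ℕ) : Commute (e p p a) (e q q b) := by
  by_cases h : p = q
  · subst h
    have := he p p p p a b
    rwa [if_pos rfl, sub_self, add_zero] at this
  · exact he.commute h (Ne.symm h) a b

section Module

variable {A M : Type*} [Ring A] [Algebra ℂ A] [AddCommGroup M] [Module ℂ M] [Module A M]
  [IsScalarTower ℂ A M]

theorem newton_smul_eq_zero (p : ℕ → A) (v : M) (hv : ∀ k, p k • v = 0)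
    (hp : ∀ i j, Commute (p i) (p j)) (k : ℕ) : newton p (k + 1) • v = 0 := by
  have h := congrArg (· • v) (newton_succ p k)
  simp only [smul_assoc, Finset.sum_smul] at h
  rw [Finset.sum_eq_zero (fun i _ => by
    rw [(commute_newton p (hp i) _).eq, mul_smul, hv, smul_zero])] at h
  exact (smul_eq_zero.mp h).resolve_left (Nat.cast_add_one_ne_zero k)

/-- The inverse form of `newton_mul_of_shift`: the factor `1 - u S` becomes the geometric series in
`u S`. -/
theorem mul_newton_of_shift (p y : ℕ → A) (hy : ∀ k b, p k * y b = y b * p k - y (b + k + 1))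
    (k b : ℕ) : y b * newton p k = ∑ j ∈ Finset.range (k + 1), newton p (k - j) * y (b + j) := by
  induction k generalizing b with
  | zero => simp [newton_zero]
  | succ k ih =>
    rw [Finset.sum_range_succ', Nat.sub_zero, add_zero b, newton_mul_of_shift p y hy k b, ih,
      ← sub_eq_iff_eq_add]
    rw [sub_sub_cancel]
    simp [add_assoc, add_comm 1]

/-- The Heisenberg relation for powers. -/
theorem heisenberg_pow {A : Type*} [Ring A] {x y z : A} (h : y * x = x * y + z) (hx : Commute z x) (hy : Commute z y)
    (T s : ℕ) : y ^ T * x ^ s = ∑ j ∈ Finset.range (s + 1),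
      ((s.choose j * T.descFactorial j : ℕ) : A) * (x ^ (s - j) * y ^ (T - j) * z ^ j) := by
  have h1 : ∀ b : ℕ, y ^ b * x = x * y ^ b + (b : A) * (y ^ (b - 1) * z) := by
    intro b
    induction b with
    | zero => simp
    | succ b ih =>
      rw [pow_succ', mul_assoc, ih, mul_add, ← mul_assoc, h]
      have : y * ((b : A) * (y ^ (b - 1) * z)) = (b : A) * (y ^ b * z) := by
        rw [← mul_assoc, ← (Nat.cast_commute b y).eq, mul_assoc]
        cases b with
        | zero => simp
        | succ b => simp [pow_succ', mul_assoc]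
      rw [this, add_mul, (hy.pow_right b).eq]
      push_cast
      noncomm_ring
  induction s with
  | zero => simp
  | succ s ih =>
    rw [pow_succ, ← mul_assoc, ih, Finset.sum_mul]
    have h2 : ∀ j ∈ Finset.range (s + 1), ((s.choose j * T.descFactorial j : ℕ) : A) *
        (x ^ (s - j) * y ^ (T - j) * z ^ j) * x =
        ((s.choose j * T.descFactorial j : ℕ) : A) * (x ^ (s + 1 - j) * y ^ (T - j) * z ^ j) +
        ((s.choose j * T.descFactorial (j + 1) : ℕ) : A) *
          (x ^ (s + 1 - (j + 1)) * y ^ (T - (j + 1)) * z ^ (j + 1)) := by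
      intro j hj
      rw [Finset.mem_range] at hj
      rw [mul_assoc _ _ x, mul_assoc _ _ x, (hx.pow_left j).eq, ← mul_assoc _ x, mul_assoc _ _ x,
        h1, show s + 1 - j = s - j + 1 by omega, Nat.add_sub_add_right,
        Nat.descFactorial_succ, show T - (j + 1) = T - j - 1 by omega, pow_succ x, pow_succ' z,
        mul_add, add_mul, mul_add]
      congr 1
      · simp only [mul_assoc]
      · rw [← mul_assoc (x ^ _) _ (_ * z), ← (Nat.cast_commute (T - j) (x ^ (s - j))).eq]
        push_cast
        have hc := (Nat.cast_commute (T - j) (T.descFactorial j : A)).eq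
        rw [hc]
        simp only [mul_assoc]
    rw [Finset.sum_congr rfl h2, Finset.sum_add_distrib, Finset.sum_range_succ' _ (s + 1),
      Finset.sum_range_succ' _ s]
    have h3 : ∀ j, (((s + 1).choose (j + 1) * T.descFactorial (j + 1) : ℕ) : A) =
        ((s.choose j * T.descFactorial (j + 1) : ℕ) : A) +
          ((s.choose (j + 1) * T.descFactorial (j + 1) : ℕ) : A) := by
      intro j
      rw [Nat.choose_succ_succ, add_mul]
      push_cast
      rfl
    simp only [h3, add_mul, Finset.sum_add_distrib]
    rw [Finset.sum_range_succ (fun j => ((s.choose (j + 1) * T.descFactorial (j + 1) : ℕ) : A) *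
      (x ^ (s + 1 - (j + 1)) * y ^ (T - (j + 1)) * z ^ (j + 1))) s]
    simp only [Nat.choose_succ_self, zero_mul, Nat.cast_zero, add_zero, Nat.choose_zero_right]
    abel

variable {n : ℕ} {e : Fin n → Fin n → ℕ → A}

/-- The sum `e p p (a + 1) + e q q (a + 1)` is central in the `𝔤𝔩_2` of `p, q`, so it commutes with
the lowering operator and reaches `w`. -/
theorem diag_sub_smul_pow {A M : Type*} [Ring A] [AddCommGroup M] [Module A M] {n : ℕ}
    {e : Fin n → Fin n → ℕ → A} (he : IsCurrentGL e) {p q : Fin n} (hpq : p ≠ q) {w : M}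
    (hp : ∀ a, e p p (a + 1) • w = 0) (hq : ∀ a, e q q (a + 1) • w = 0) (a s : ℕ) :
    e q q (a + 1) • e q p 0 ^ s • w = -(e p p (a + 1) • e q p 0 ^ s • w) := by
  have hc : Commute (e q q (a + 1) + e p p (a + 1)) (e q p 0) := by
    have h1 := he q q q p (a + 1) 0
    have h2 := he p p q p (a + 1) 0
    simp only [if_true, if_neg hpq, zero_sub, sub_zero] at h1 h2
    show _ * _ = _ * _
    rw [add_mul, mul_add, h1, h2]
    abel
  rw [eq_neg_iff_add_eq_zero, ← add_smul, ← mul_smul, (hc.pow_right s).eq, mul_smul, add_smul,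
    hp, hq, add_zero, smul_zero]

theorem diag_smul_pow_succ (he : IsCurrentGL e) {p q : Fin n} (hpq : p ≠ q) {w : M}
    (hp : ∀ a, e p p (a + 1) • w = 0) (a s : ℕ) :
    e p p (a + 1) • e q p 0 ^ (s + 1) • w = -(((s : ℂ) + 1) • e q p (a + 1) • e q p 0 ^ s • w) := by
  have hc : Commute (e q p (a + 1)) (e q p 0) := he.commute hpq hpq _ _
  have h2 := he p p q p (a + 1) 0
  simp only [if_true, if_neg hpq, zero_sub, add_zero] at h2
  induction s with
  | zero =>
    rw [pow_one, ← mul_smul, h2, add_smul, mul_smul, hp, smul_zero]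
    simp
  | succ s ih =>
    have h3 : e q p (a + 1) • e q p 0 • e q p 0 ^ s • w =
        e q p (a + 1) • e q p 0 ^ (s + 1) • w := by rw [pow_succ', mul_smul (e q p 0)]
    rw [pow_succ', mul_smul, ← mul_smul, h2, add_smul, mul_smul, ih, smul_neg,
      smul_comm _ ((s : ℂ) + 1), neg_smul, ← mul_smul (e q p 0), ← hc.eq, mul_smul, h3]
    generalize e q p (a + 1) • e q p 0 ^ (s + 1) • w = u
    push_cast
    module

/-- The commutator with each lowering factor is `e p p - e q q` in degree `a + 1`, which acts on `e
q p 0 ^ s • w` as `2 e p p` by `diag_sub_smul_pow`; the corrections from moving it across the other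
factors bring the total coefficient to `s + 1`. -/
theorem raising_smul_pow_succ (he : IsCurrentGL e) {p q : Fin n} (hpq : p ≠ q) {w : M}
    (hr : ∀ a, e p q a • w = 0) (hp : ∀ a, e p p (a + 1) • w = 0)
    (hq : ∀ a, e q q (a + 1) • w = 0) (a s : ℕ) :
    e p q (a + 1) • e q p 0 ^ (s + 1) • w = ((s : ℂ) + 1) • e p p (a + 1) • e q p 0 ^ s • w := by
  have h3 := he p q q p (a + 1) 0
  simp only [if_true, add_zero] at h3
  induction s with
  | zero =>
    rw [pow_one, ← mul_smul, h3, add_smul, mul_smul, hr, smul_zero, sub_smul, hp, hq]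
    simp [hp]
  | succ s ih =>
    have h2 := he p p q p (a + 1) 0
    simp only [if_true, if_neg hpq, zero_sub, add_zero] at h2
    have h4 : e q p 0 • e p p (a + 1) • e q p 0 ^ s • w =
        e p p (a + 1) • e q p 0 ^ (s + 1) • w + e q p (a + 1) • e q p 0 ^ s • w := by
      rw [pow_succ', mul_smul, ← mul_smul (e p p (a + 1)) (e q p 0), h2, add_smul, mul_smul,
        neg_smul, neg_add_cancel_right]
    have h5 := diag_smul_pow_succ he hpq hp a s
    rw [pow_succ', mul_smul, ← mul_smul, h3, add_smul, mul_smul, ih,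
      smul_comm _ ((s : ℂ) + 1), h4, sub_smul, diag_sub_smul_pow he hpq hp hq, smul_add,
      ← neg_eq_iff_eq_neg.mpr h5]
    generalize e p p (a + 1) • e q p 0 ^ (s + 1) • w = u
    push_cast
    module

/-- The relations of Garland type satisfied by a highest weight vector. -/
theorem newton_smul_pow_smul (he : IsCurrentGL e) {p q : Fin n} (hpq : p ≠ q) {w : M}
    (hr : ∀ a, e p q a • w = 0) (hp : ∀ a, e p p (a + 1) • w = 0)
    (hq : ∀ a, e q q (a + 1) • w = 0) {m : ℕ} (hm : e q p 0 ^ (m + 1) • w = 0) (k s : ℕ)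
    (hks : m < k + s) : newton (fun k => -e p p (k + 1)) k • e q p 0 ^ s • w = 0 := by
  induction k generalizing s with
  | zero =>
    obtain ⟨t, rfl⟩ : ∃ t, s = t + (m + 1) := ⟨s - (m + 1), by omega⟩
    rw [newton_zero, one_smul, pow_add, mul_smul, hm, smul_zero]
  | succ k ih =>
    set P : ℕ → A := fun k => -e p p (k + 1) with hP
    have hcomm : ∀ i j, Commute (P i) (P j) := fun i j =>
      (he.commute_diag p p _ _).neg_left.neg_right
    have hshift : ∀ k b, P k * e p q b = e p q b * P k - e p q (b + k + 1) := by
      intro k b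
      have := he p p p q (k + 1) b
      simp only [if_true, if_neg hpq.symm, sub_zero] at this
      rw [hP]
      simp only [neg_mul, mul_neg, this]
      rw [show k + 1 + b = b + k + 1 by omega]
      abel
    -- Applying the raising operator of degree one to the relation for `(k, s + 1)` yields, by
    -- Newton's identity, a nonzero multiple of the relation for `(k + 1, s)`.
    have h1 := congrArg (e p q 1 • ·) (ih (s + 1) (by omega))
    simp only [smul_zero] at h1
    rw [← mul_smul, mul_newton_of_shift P (e p q) hshift k 1, Finset.sum_smul] at h1
    have h2 : ∀ j ∈ Finset.range (k + 1), (newton P (k - j) * e p q (1 + j)) •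
        e q p 0 ^ (s + 1) • w =
        (-((s : ℂ) + 1)) • (P j * newton P (k - j)) • e q p 0 ^ s • w := by
      intro j _
      rw [mul_smul, add_comm 1 j, raising_smul_pow_succ he hpq hr hp hq,
        (commute_newton P (hcomm j) _).eq, mul_smul, smul_comm _ ((s : ℂ) + 1), hP]
      simp only [neg_smul, smul_neg, neg_neg]
    rw [Finset.sum_congr rfl h2, ← Finset.smul_sum, ← Finset.sum_smul, ← newton_succ,
      smul_assoc, smul_smul] at h1
    refine (smul_eq_zero.mp h1).resolve_left (mul_ne_zero (neg_ne_zero.mpr ?_) ?_) <;>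
      exact Nat.cast_add_one_ne_zero _

/-- A locally nilpotent lowering operator annihilates a highest weight vector of weight `m` after
`m + 1` steps. -/
theorem lowering_pow_smul_eq_zero (he : IsCurrentGL e) {p q : Fin n} (hpq : p ≠ q) {w : M}
    (hr : e p q 0 • w = 0) {c d : ℂ} (hp : e p p 0 • w = c • w) (hq : e q q 0 • w = d • w) {m : ℕ}
    (hm : c - d = m) (hnil : ∃ k, e q p 0 ^ k • w = 0) : e q p 0 ^ (m + 1) • w = 0 := by
  have h1 := he p q q p 0 0
  have h2 := he p p q p 0 0
  have h3 := he q q q p 0 0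
  simp only [if_true, if_neg hpq, add_zero, zero_sub, sub_zero] at h1 h2 h3
  have hweight : ∀ k : ℕ, (e p p 0 - e q q 0) • e q p 0 ^ k • w =
      (c - d - 2 * k) • e q p 0 ^ k • w := by
    intro k
    induction k with
    | zero => simp [sub_smul, hp, hq]
    | succ k ih =>
      have : (e p p 0 - e q q 0) * e q p 0 = e q p 0 * (e p p 0 - e q q 0) - 2 * e q p 0 := by
        rw [sub_mul, h2, h3]
        noncomm_ring
      rw [pow_succ', mul_smul, ← mul_smul, this, sub_smul, mul_smul, ih,
        smul_comm _ (c - d - 2 * (k : ℂ)), two_mul (e q p 0), add_smul]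
      generalize e q p 0 • e q p 0 ^ k • w = u
      push_cast
      module
  have hraise : ∀ k : ℕ, e p q 0 • e q p 0 ^ (k + 1) • w =
      (((k : ℂ) + 1) * (c - d - k)) • e q p 0 ^ k • w := by
    intro k
    induction k with
    | zero =>
      rw [pow_one, ← mul_smul, h1, add_smul, mul_smul, hr, smul_zero, sub_smul, hp, hq]
      simp [sub_smul]
    | succ k ih =>
      rw [pow_succ', mul_smul, ← mul_smul, h1, add_smul, mul_smul, ih, hweight,
        smul_comm (e q p 0) (_ : ℂ), ← mul_smul (e q p 0), ← pow_succ']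
      generalize e q p 0 ^ (k + 1) • w = u
      push_cast
      module
  obtain ⟨k, hk⟩ := hnil
  -- The coefficient `(k + 1)(m - k)` in `hraise` is nonzero for `k > m`, so vanishing descends from
  -- the power `k + 1` to the power `k`, down to `m + 1`.
  have key : ∀ j, e q p 0 ^ (m + 1 + j) • w = 0 → e q p 0 ^ (m + 1) • w = 0 := by
    intro j
    induction j with
    | zero => exact id
    | succ j ih =>
      intro h
      apply ih
      have h4 := hraise (m + 1 + j)
      rw [show m + 1 + j + 1 = m + 1 + (j + 1) by omega, h, smul_zero, hm] at h4
      refine (smul_eq_zero.mp h4.symm).resolve_left (mul_ne_zero ?_ ?_)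
      · exact Nat.cast_add_one_ne_zero _
      · push_cast
        rw [show (m : ℂ) - (m + 1 + j) = -((j : ℂ) + 1) by ring]
        exact neg_ne_zero.mpr (Nat.cast_add_one_ne_zero j)
  refine key k ?_
  rw [pow_add, mul_smul, hk, smul_zero]

end Module

/-! ### Monomials in the last row as seen by the upper left block. -/

section Block

variable {r : ℕ} {A M : Type*} [Ring A] [Algebra ℂ A] [AddCommGroup M] [Module ℂ M] [Module A M]
  [IsScalarTower ℂ A M]

/-- The subalgebra generated by the upper left block of size `r + 1`. -/
def block (e : Fin (r + 2) → Fin (r + 2) → ℕ → A) : Subalgebra ℂ A :=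
  Algebra.adjoin ℂ {x | ∃ (p q : Fin (r + 1)) (a : ℕ), x = e p.castSucc q.castSucc a}

theorem mem_block (e : Fin (r + 2) → Fin (r + 2) → ℕ → A) (p q : Fin (r + 1)) (a : ℕ) :
    e p.castSucc q.castSucc a ∈ block e :=
  Algebra.subset_adjoin ⟨p, q, a, rfl⟩

theorem smul_mem_of_mem_block {M : Type*} [AddCommGroup M] [Module A M]
    {e : Fin (r + 2) → Fin (r + 2) → ℕ → A} (N : Submodule (block e) M)
    {b : A} (hb : b ∈ block e) {x : M} (hx : x ∈ N) : b • x ∈ N :=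
  N.smul_mem ⟨b, hb⟩ hx

theorem csmul_mem {e : Fin (r + 2) → Fin (r + 2) → ℕ → A} (N : Submodule (block e) M) (c : ℂ)
    {x : M} (hx : x ∈ N) : c • x ∈ N :=
  N.smul_of_tower_mem c hx

/-- The vector obtained from `w` by a monomial in the lowering operators in the last row. -/
def lowVec (φ : MvPolynomial (Fin (r + 1)) ℂ →ₐ[ℂ] A) (w : M) (s : Fin (r + 1) →₀ ℕ) : M :=
  φ (MvPolynomial.monomial s 1) • w

/-- The height of an exponent; replacing an index by a larger one decreases it. -/
def ht (s : Fin (r + 1) →₀ ℕ) : ℕ := ∑ i : Fin (r + 1), (r - (i : ℕ)) * s i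

theorem ht_add (s t : Fin (r + 1) →₀ ℕ) : ht (s + t) = ht s + ht t := by
  simp [ht, mul_add, Finset.sum_add_distrib]

theorem ht_single (i : Fin (r + 1)) (a : ℕ) : ht (Finsupp.single i a) = (r - (i : ℕ)) * a := by
  rw [ht, Finset.sum_eq_single i]
  · simp
  · intro j _ hj
    simp [hj.symm]
  · simp

variable {e : Fin (r + 2) → Fin (r + 2) → ℕ → A} (he : IsCurrentGL e)
  {φ : MvPolynomial (Fin (r + 1)) ℂ →ₐ[ℂ] A}
  (hφ : ∀ i, φ (MvPolynomial.X i) = e (Fin.last _) i.castSucc 0)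

include he hφ

theorem commute_lower_map (j : Fin (r + 1)) (a : ℕ) (P : MvPolynomial (Fin (r + 1)) ℂ) :
    Commute (e (Fin.last _) j.castSucc a) (φ P) := by
  induction P using MvPolynomial.induction_on with
  | C c =>
    rw [← MvPolynomial.algebraMap_eq, AlgHom.commutes]
    exact Algebra.commute_algebraMap_right _ _
  | add P Q hP hQ => rw [map_add]; exact hP.add_right hQ
  | mul_X P i hP =>
    rw [map_mul, hφ]
    exact hP.mul_right (he.commute (Fin.castSucc_lt_last _).ne (Fin.castSucc_lt_last _).ne _ _)

/-- The commutator with a block element is a derivation on the commuting variables of the last row;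
it sends only the variable `p` to something nonzero, namely `-e (Fin.last _) q.castSucc a`. -/
theorem block_mul_map (p q : Fin (r + 1)) (a : ℕ) (P : MvPolynomial (Fin (r + 1)) ℂ) :
    e p.castSucc q.castSucc a * φ P = φ P * e p.castSucc q.castSucc a -
      e (Fin.last _) q.castSucc a * φ (MvPolynomial.pderiv p P) := by
  induction P using MvPolynomial.induction_on with
  | C c =>
    rw [MvPolynomial.pderiv_C, map_zero, mul_zero, sub_zero, ← MvPolynomial.algebraMap_eq,
      AlgHom.commutes]
    exact (Algebra.commutes _ _).symm
  | add P Q hP hQ =>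
    simp only [map_add, mul_add, add_mul, hP, hQ]
    abel
  | mul_X P i hP =>
    have h1 := he p.castSucc q.castSucc (Fin.last _) i.castSucc a 0
    rw [if_neg (Fin.castSucc_lt_last _).ne, zero_sub, add_zero] at h1
    have hc := (commute_lower_map he hφ q a P).eq
    have hd := (commute_lower_map he hφ i 0 (MvPolynomial.pderiv p P)).eq
    rw [map_mul, ← mul_assoc, hP, sub_mul, mul_assoc, hφ, h1, Derivation.leibniz,
      MvPolynomial.pderiv_X, map_add, smul_eq_mul, smul_eq_mul, map_mul, map_mul, hφ]
    by_cases hip : i = p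
    · subst hip
      rw [if_pos rfl, Pi.single_eq_same, map_one, mul_one, mul_add, mul_neg, mul_add, hc,
        hd]
      noncomm_ring
    · rw [if_neg (by simpa using hip), Pi.single_eq_of_ne hip, map_zero, mul_zero, zero_add, hd]
      noncomm_ring

theorem block_smul_lowVec (w : M) (p q : Fin (r + 1)) (a : ℕ) (s : Fin (r + 1) →₀ ℕ) :
    e p.castSucc q.castSucc a • lowVec φ w s =
      φ (MvPolynomial.monomial s 1) • e p.castSucc q.castSucc a • w -
      (s p : ℂ) • e (Fin.last _) q.castSucc a • lowVec φ w (s - Finsupp.single p 1) := by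
  rw [lowVec, ← mul_smul, block_mul_map he hφ, sub_smul, mul_smul, mul_smul,
    MvPolynomial.pderiv_monomial, one_mul, lowVec]
  congr 1
  rw [show MvPolynomial.monomial (s - Finsupp.single p 1) (s p : ℂ) =
    (s p : ℂ) • MvPolynomial.monomial (s - Finsupp.single p 1) 1 by
      rw [MvPolynomial.smul_monomial, smul_eq_mul, mul_one], map_smul, smul_assoc, smul_comm]

omit he [Module ℂ M] [IsScalarTower ℂ A M] in
theorem lowVec_add_single (w : M) (i : Fin (r + 1)) (s : Fin (r + 1) →₀ ℕ) :
    lowVec φ w (s + Finsupp.single i 1) = e (Fin.last _) i.castSucc 0 • lowVec φ w s := by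
  rw [lowVec, lowVec, ← hφ, ← mul_smul, ← map_mul, add_comm s, MvPolynomial.X,
    MvPolynomial.monomial_mul, mul_one]

variable {c : Fin (r + 2) → ℂ} {w : M} (hw : IsHighestWeight e c w)

include hw

theorem diag_pos_smul_lowVec (p : Fin (r + 1)) (a : ℕ) (s : Fin (r + 1) →₀ ℕ) :
    e p.castSucc p.castSucc (a + 1) • lowVec φ w s =
      -((s p : ℂ) • e (Fin.last _) p.castSucc (a + 1) • lowVec φ w (s - Finsupp.single p 1)) := by
  rw [block_smul_lowVec he hφ, hw.cartan_pos, smul_zero, zero_sub]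

theorem diag_zero_smul_lowVec (p : Fin (r + 1)) (s : Fin (r + 1) →₀ ℕ) :
    e p.castSucc p.castSucc 0 • lowVec φ w s = (c p.castSucc - s p) • lowVec φ w s := by
  rw [block_smul_lowVec he hφ, hw.cartan_zero, smul_comm, ← lowVec, sub_smul]
  congr 1
  by_cases hs : s p = 0
  · simp [hs]
  · rw [← lowVec_add_single hφ, tsub_add_cancel_of_le
      (Finsupp.single_le_iff.mpr (Nat.one_le_iff_ne_zero.mpr hs))]

/-- A lowering operator of positive degree is traded for a degree zero one and a diagonal element of
the block: `e q q (a + 1)` applied to the monomial with one more factor `q` gives the wanted vector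
up to the factor `-(s q + 1)`. This is why monomials of degree zero suffice. -/
theorem lower_smul_lowVec_mem (N : Submodule (block e) M) (q : Fin (r + 1)) (a : ℕ)
    (s : Fin (r + 1) →₀ ℕ) (h : lowVec φ w (s + Finsupp.single q 1) ∈ N) :
    e (Fin.last _) q.castSucc a • lowVec φ w s ∈ N := by
  cases a with
  | zero => rwa [← lowVec_add_single hφ]
  | succ a =>
    have h1 := diag_pos_smul_lowVec he hφ hw q a (s + Finsupp.single q 1)
    rw [add_tsub_cancel_right] at h1
    have h2 : (((s + Finsupp.single q 1 : Fin (r + 1) →₀ ℕ) q : ℕ) : ℂ) ≠ 0 := by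
      simpa using Nat.cast_add_one_ne_zero (s q)
    have h3 := csmul_mem N (-(((s + Finsupp.single q 1 : Fin (r + 1) →₀ ℕ) q : ℕ) : ℂ)⁻¹)
      (smul_mem_of_mem_block N (mem_block e q q (a + 1)) h)
    rwa [h1, neg_smul, smul_neg, neg_neg, smul_smul, inv_mul_cancel₀ h2, one_smul] at h3

variable {ψ : PowerSums (r + 1) →ₐ[ℂ] A}
  (hψ : ∀ i k, ψ (psum i k) = -e i.castSucc i.castSucc (k + 1))

omit he hφ hw in
include hψ in
theorem map_mem_block (P : PowerSums (r + 1)) : ψ P ∈ block e := by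
  induction P using MvPolynomial.induction_on with
  | C c =>
    rw [← MvPolynomial.algebraMap_eq, AlgHom.commutes]
    exact (block e).algebraMap_mem c
  | add P Q hP hQ => rw [map_add]; exact add_mem hP hQ
  | mul_X P i hP =>
    rw [map_mul, show MvPolynomial.X i = psum i.1 i.2 from rfl, hψ]
    exact mul_mem hP (neg_mem (mem_block e _ _ _))

omit hφ hw in
include hψ in
theorem diag_commute_map (p : Fin (r + 1)) (P : PowerSums (r + 1)) (a : ℕ) :
    Commute (e p.castSucc p.castSucc a) (ψ P) := by
  induction P using MvPolynomial.induction_on with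
  | C c =>
    rw [← MvPolynomial.algebraMap_eq, AlgHom.commutes]
    exact Algebra.commute_algebraMap_right _ _
  | add P Q hP hQ => rw [map_add]; exact hP.add_right hQ
  | mul_X P i hP =>
    rw [map_mul, show MvPolynomial.X i = psum i.1 i.2 from rfl, hψ]
    exact hP.mul_right (he.commute_diag _ _ _ _).neg_right

-- Up to a scalar, the commutator turns one factor `p` of the monomial into a factor `q > p`, up to
-- elements of the block, and this lowers `ht`. The commutators with the diagonal elements in `ψ P`
-- are again raising operators in the same position `(p, q)`.
include hψ in
theorem raising_smul_mem (N : Submodule (block e) M) (s : Fin (r + 1) →₀ ℕ)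
    (hN : ∀ t, ht t < ht s → lowVec φ w t ∈ N) (p q : Fin (r + 1)) (hpq : p < q) (a : ℕ)
    (P : PowerSums (r + 1)) : e p.castSucc q.castSucc a • ψ P • lowVec φ w s ∈ N := by
  induction P using MvPolynomial.induction_on generalizing a with
  | C c =>
    rw [← MvPolynomial.algebraMap_eq, AlgHom.commutes, algebraMap_smul, smul_comm]
    apply csmul_mem
    rw [block_smul_lowVec he hφ, hw.raising _ _ _ (by simpa using hpq), smul_zero, zero_sub]
    by_cases hs : s p = 0
    · simp [hs]
    · refine neg_mem (csmul_mem N _ (lower_smul_lowVec_mem he hφ hw N q a _ (hN _ ?_)))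
      obtain ⟨t, rfl⟩ : ∃ t, s = t + Finsupp.single p 1 := ⟨s - Finsupp.single p 1,
        (tsub_add_cancel_of_le (Finsupp.single_le_iff.mpr (Nat.one_le_iff_ne_zero.mpr hs))).symm⟩
      rw [add_tsub_cancel_right, ht_add, ht_add, ht_single, ht_single]
      have := q.2
      have : (p : ℕ) < q := hpq
      omega
  | add P Q hP hQ =>
    rw [map_add, add_smul, smul_add]
    exact add_mem (hP a) (hQ a)
  | mul_X P i hP =>
    rw [mul_comm, map_mul, show MvPolynomial.X i = psum i.1 i.2 from rfl, hψ, mul_smul, neg_smul,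
      smul_neg, ← mul_smul, he, add_smul, mul_smul]
    refine neg_mem (add_mem (smul_mem_of_mem_block N (mem_block e _ _ _) (hP a)) ?_)
    rw [sub_smul]
    refine sub_mem ?_ ?_
    · split_ifs with h
      · rw [← h]; exact hP _
      · simp
    · split_ifs with h
      · rw [h]; exact hP _
      · simp

/-- Moving past one factor with index `i` lowers the degree of the elementary function by at most
one, so after all `s i` factors the degree is still positive, and the remaining vector is killed. -/
theorem elementary_smul_lowVec (i : Fin (r + 1)) (s : Fin (r + 1) →₀ ℕ) (k : ℕ) (hk : s i < k) :
    newton (fun k => e i.castSucc i.castSucc (k + 1)) k • lowVec φ w s = 0 := by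
  have hcomm : ∀ j l, Commute (e i.castSucc i.castSucc (j + 1)) (e i.castSucc i.castSucc (l + 1)) :=
    fun j l => he.commute_diag _ _ _ _
  have hshift : ∀ k b, e i.castSucc i.castSucc (k + 1) * e (Fin.last _) i.castSucc b =
      e (Fin.last _) i.castSucc b * e i.castSucc i.castSucc (k + 1) -
        e (Fin.last _) i.castSucc (b + k + 1) := by
    intro k b
    rw [he, if_neg (Fin.castSucc_lt_last _).ne, if_pos rfl, show k + 1 + b = b + k + 1 by omega,
      zero_sub, sub_eq_add_neg]
  induction hn : s i generalizing s k with
  | zero =>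
    obtain ⟨k, rfl⟩ : ∃ l, k = l + 1 := ⟨k - 1, by omega⟩
    refine newton_smul_eq_zero _ _ (fun j => ?_) hcomm k
    rw [diag_pos_smul_lowVec he hφ hw, hn]
    simp
  | succ n ih =>
    obtain ⟨k, rfl⟩ : ∃ l, k = l + 1 := ⟨k - 1, by omega⟩
    obtain ⟨t, rfl⟩ : ∃ t, s = t + Finsupp.single i 1 := ⟨s - Finsupp.single i 1,
      (tsub_add_cancel_of_le (Finsupp.single_le_iff.mpr (by omega))).symm⟩
    have hti : t i = n := by simpa using hn
    rw [lowVec_add_single hφ, ← mul_smul,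
      newton_mul_of_shift _ (e (Fin.last _) i.castSucc) hshift, sub_smul, mul_smul, mul_smul,
      ih t (k + 1) (by omega) hti, ih t k (by omega) hti, smul_zero, smul_zero, sub_zero]

omit hw in
theorem newton_commute_map (i : Fin (r + 1)) (k : ℕ) (t : Fin (r + 1) →₀ ℕ) (ht : t i = 0) :
    Commute (φ (MvPolynomial.monomial t 1))
      (newton (fun k => -e i.castSucc i.castSucc (k + 1)) k) := by
  refine commute_newton _ (fun j => Commute.neg_right ?_) k
  have := block_mul_map he hφ i i (j + 1) (MvPolynomial.monomial t 1)
  rw [MvPolynomial.pderiv_monomial, ht, Nat.cast_zero, mul_zero, map_zero, map_zero, mul_zero,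
    sub_zero] at this
  exact this.symm

omit he hw in
theorem map_monomial_single (i : Fin (r + 1)) (a : ℕ) :
    φ (MvPolynomial.monomial (Finsupp.single i a) 1) = e (Fin.last _) i.castSucc 0 ^ a := by
  rw [← hφ, ← map_pow, MvPolynomial.X_pow_eq_monomial]

variable {m : Fin (r + 1) → ℕ}
  (hm : ∀ i : Fin (r + 1), e i.succ i.castSucc 0 ^ (m i + 1) • w = 0)

include hm

theorem complete_smul_lowVec_last (s : Fin (r + 1) →₀ ℕ) (k : ℕ)
    (hk : m (Fin.last r) < k + s (Fin.last r)) :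
    newton (fun k => -e (Fin.last r).castSucc (Fin.last r).castSucc (k + 1)) k •
      lowVec φ w s = 0 := by
  set i := Fin.last r with hi
  obtain ⟨t, a, hta, rfl⟩ : ∃ (t : Fin (r + 1) →₀ ℕ) (a : ℕ), t i = 0 ∧
      s = t + Finsupp.single i a :=
    ⟨s.erase i, s i, by simp, (Finsupp.erase_add_single i s).symm⟩
  have hlt : i.castSucc < Fin.last (r + 1) := Fin.castSucc_lt_last i
  have h := newton_smul_pow_smul he (p := i.castSucc) (q := Fin.last (r + 1)) (w := w) (m := m i)
    hlt.ne (fun a => hw.raising _ _ a hlt) (hw.cartan_pos _) (hw.cartan_pos _) (hm i) k a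
    (by simpa [hta] using hk)
  rw [lowVec, show MvPolynomial.monomial (t + Finsupp.single i a) (1 : ℂ) =
    MvPolynomial.monomial t 1 * MvPolynomial.monomial (Finsupp.single i a) 1 by
      rw [MvPolynomial.monomial_mul, mul_one], map_mul, map_monomial_single hφ, ← mul_smul,
    ← mul_assoc, ← (newton_commute_map he hφ i k t hta).eq, mul_assoc, mul_smul, mul_smul, h,
    smul_zero]

/-- Garland's identity for the simple root `(i, j)` concerns powers of `x = e j i`, not the last
row. Applying `y ^ (a + b)`, with `y` the last row operator at `j`, converts `x` into `z = [y, x]`,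
the last row operator at `i`. The term in which every `x` is converted is the monomial for `s`; the
others are powers of `x` on monomials of smaller height. -/
theorem complete_smul_lowVec_castSucc (N : Submodule (block e) M) (s : Fin (r + 1) →₀ ℕ)
    (hN : ∀ t, ht t < ht s → lowVec φ w t ∈ N) (i : Fin (r + 1)) (j : Fin (r + 1))
    (hij : (j : ℕ) = i + 1) (k : ℕ) (hk : m i < k + s i) :
    newton (fun k => -e i.castSucc i.castSucc (k + 1)) k • lowVec φ w s ∈ N := by
  have hlt : i < j := by rw [Fin.lt_def]; omega
  have hsucc : i.succ = j.castSucc := by ext; simp [hij]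
  obtain ⟨t, a, b, hti, htj, rfl⟩ : ∃ (t : Fin (r + 1) →₀ ℕ) (a b : ℕ), t i = 0 ∧ t j = 0 ∧
      s = t + Finsupp.single j b + Finsupp.single i a := by
    refine ⟨(s.erase i).erase j, s i, s j, ?_, by simp, ?_⟩
    · rw [Finsupp.erase_ne hlt.ne, Finsupp.erase_same]
    · rw [← Finsupp.erase_ne hlt.ne', Finsupp.erase_add_single, Finsupp.erase_add_single]
  have hka : m i < k + a := by simpa [hti, hlt.ne'] using hk
  set h := newton (fun k => -e i.castSucc i.castSucc (k + 1)) k with hh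
  have hhmem : h ∈ block e := newton_mem _ _ (fun l => neg_mem (mem_block e i i (l + 1))) k
  set x := e j.castSucc i.castSucc 0 with hx
  set y := e (Fin.last _) j.castSucc 0 with hy
  set z := e (Fin.last _) i.castSucc 0 with hz
  have hvec : ∀ b a, lowVec φ w (t + Finsupp.single j b + Finsupp.single i a) =
      φ (MvPolynomial.monomial t 1) • y ^ b • z ^ a • w := by
    intro b a
    rw [lowVec, ← map_monomial_single hφ, ← map_monomial_single hφ, ← mul_smul, ← mul_smul,
      ← map_mul, ← map_mul, MvPolynomial.monomial_mul, MvPolynomial.monomial_mul]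
    simp
  have hg : h • x ^ a • w = 0 := by
    have := hm i
    rw [hsucc] at this
    exact newton_smul_pow_smul he (p := i.castSucc) (q := j.castSucc) (w := w) (m := m i)
      (by simpa using hlt.ne) (fun a => hw.raising _ _ a (by simpa using hlt)) (hw.cartan_pos _)
      (hw.cartan_pos _) this k a hka
  have hyx : y * x = x * y + z := by
    rw [hy, hx, he, if_pos rfl, if_neg (Fin.castSucc_lt_last _).ne, sub_zero]
  have hzx : Commute z x := he.commute (by simpa using hlt.ne) (Fin.castSucc_lt_last _).ne _ _
  have hzy : Commute z y := he.commute (Fin.castSucc_lt_last _).ne (Fin.castSucc_lt_last _).ne _ _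
  have hxt : Commute x (φ (MvPolynomial.monomial t 1)) := by
    have := block_mul_map he hφ j i 0 (MvPolynomial.monomial t 1)
    rwa [MvPolynomial.pderiv_monomial, htj, Nat.cast_zero, mul_zero, map_zero, map_zero, mul_zero,
      sub_zero] at this
  have hth := newton_commute_map he hφ i k t hti
  have hyh : Commute (y ^ (a + b)) h := by
    have := newton_commute_map he hφ i k (Finsupp.single j (a + b))
      (by simp [hlt.ne'])
    rwa [map_monomial_single hφ] at this
  have hzero : h • φ (MvPolynomial.monomial t 1) • y ^ (a + b) • x ^ a • w = 0 := by
    rw [← mul_smul, ← hth.eq, mul_smul, ← mul_smul h, ← hyh.eq, mul_smul, hg, smul_zero, smul_zero]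
  rw [← mul_smul (y ^ (a + b)), heisenberg_pow hyx hzx hzy, Finset.sum_smul, Finset.smul_sum,
    Finset.smul_sum, Finset.sum_range_succ] at hzero
  have hterm : ∀ l ≤ a, φ (MvPolynomial.monomial t 1) • (((a.choose l * (a + b).descFactorial l :
      ℕ) : A) * (x ^ (a - l) * y ^ (a + b - l) * z ^ l)) • w =
      ((a.choose l * (a + b).descFactorial l : ℕ) : ℂ) • x ^ (a - l) •
        lowVec φ w (t + Finsupp.single j (a + b - l) + Finsupp.single i l) := by
    intro l _
    generalize a.choose l * (a + b).descFactorial l = d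
    rw [hvec, mul_smul, Nat.cast_smul_eq_nsmul, Nat.cast_smul_eq_nsmul, smul_comm, mul_assoc,
      mul_smul, ← mul_smul _ (x ^ _), ← (hxt.pow_left _).eq, mul_smul, mul_smul]
  have hlast := hterm a le_rfl
  rw [Nat.sub_self, pow_zero, one_smul, Nat.choose_self, one_mul, Nat.add_sub_cancel_left] at hlast
  rw [Nat.sub_self, pow_zero, Nat.choose_self, one_mul, Nat.add_sub_cancel_left, hlast,
    smul_comm] at hzero
  -- The exponent `a + b` leaves exactly `y ^ b` in the top term and makes its coefficient nonzero.
  have hne : (((a + b).descFactorial a : ℕ) : ℂ) ≠ 0 := by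
    rw [Nat.cast_ne_zero, Ne, Nat.descFactorial_eq_zero_iff_lt]
    omega
  have hmem : ((((a + b).descFactorial a : ℕ) : ℂ) • h •
      lowVec φ w (t + Finsupp.single j b + Finsupp.single i a)) ∈ N := by
    rw [eq_neg_of_add_eq_zero_right hzero]
    refine neg_mem (sum_mem fun l hl => ?_)
    rw [Finset.mem_range] at hl
    rw [hterm l hl.le]
    refine smul_mem_of_mem_block N hhmem (csmul_mem N _ (smul_mem_of_mem_block N
      (pow_mem (mem_block e j i 0) _) (hN _ ?_)))
    rw [ht_add, ht_add, ht_add, ht_add, ht_single, ht_single, ht_single, ht_single]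
    obtain ⟨d, rfl⟩ : ∃ d, a = l + (d + 1) := ⟨a - l - 1, by omega⟩
    have hjr := j.2
    obtain ⟨u, hu⟩ : ∃ u, r - (j : ℕ) = u := ⟨_, rfl⟩
    have hu' : r - (i : ℕ) = u + 1 := by omega
    rw [hu, hu', show l + (d + 1) + b - l = b + (d + 1) by omega]
    nlinarith
  have := csmul_mem N (((a + b).descFactorial a : ℕ) : ℂ)⁻¹ hmem
  rwa [smul_smul, inv_mul_cancel₀ hne, one_smul] at this

include hψ in
theorem boxIdeal_smul_mem (N : Submodule (block e) M) (s : Fin (r + 1) →₀ ℕ)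
    (hN : ∀ t, ht t < ht s → lowVec φ w t ∈ N) (P : PowerSums (r + 1)) (hP : P ∈ boxIdeal m s) :
    ψ P • lowVec φ w s ∈ N := by
  rw [boxIdeal] at hP
  induction hP using Submodule.span_induction with
  | mem P hP =>
    cases hP with
    | complete i k hk =>
      rw [map_newton]
      simp only [hψ]
      by_cases hi : i = Fin.last r
      · subst hi
        rw [complete_smul_lowVec_last he hφ hw hm s k hk]
        exact zero_mem N
      · have hir : (i : ℕ) < r := Fin.val_lt_last hi
        exact complete_smul_lowVec_castSucc he hφ hw hm N s hN i ⟨i + 1, by omega⟩ rfl k hk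
    | elementary i k hk =>
      rw [map_newton]
      simp only [map_neg, hψ, neg_neg]
      rw [elementary_smul_lowVec he hφ hw i s k hk]
      exact zero_mem N
  | zero => simp
  | add P Q _ _ hP hQ =>
    rw [map_add, add_smul]
    exact add_mem hP hQ
  | smul a P _ hP =>
    rw [smul_eq_mul, map_mul, mul_smul]
    exact smul_mem_of_mem_block N (map_mem_block hψ a) hP

end Block

/-! ### The monomials of the last row generate everything over the block. -/

section Spanning

variable {r : ℕ} {A M : Type*} [Ring A] [Algebra ℂ A] [AddCommGroup M] [Module ℂ M] [Module A M]
  [IsScalarTower ℂ A M]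

theorem smul_mem_of_mem_adjoin {X : Set A} (T : Submodule ℂ M) (hT : ∀ b ∈ X, ∀ x ∈ T, b • x ∈ T)
    {b : A} (hb : b ∈ Algebra.adjoin ℂ X) {x : M} (hx : x ∈ T) : b • x ∈ T := by
  induction hb using Algebra.adjoin_induction generalizing x with
  | mem b hb => exact hT b hb x hx
  | algebraMap c => rw [algebraMap_smul]; exact T.smul_mem c hx
  | add b b' _ _ hb hb' => rw [add_smul]; exact add_mem (hb hx) (hb' hx)
  | mul b b' _ _ hb hb' => rw [mul_smul]; exact hb (hb' hx)

variable {e : Fin (r + 2) → Fin (r + 2) → ℕ → A} (he : IsCurrentGL e)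
  {φ : MvPolynomial (Fin (r + 1)) ℂ →ₐ[ℂ] A}
  (hφ : ∀ i, φ (MvPolynomial.X i) = e (Fin.last _) i.castSucc 0)
  {c : Fin (r + 2) → ℂ} {w : M} (hw : IsHighestWeight e c w)

theorem mem_of_mem_span_block {X : Set M} (T : Submodule ℂ M) (hX : ∀ x ∈ X, x ∈ T)
    (hT : ∀ (p q : Fin (r + 1)) (a : ℕ), ∀ x ∈ T, e p.castSucc q.castSucc a • x ∈ T) {x : M}
    (hx : x ∈ Submodule.span (block e) X) : x ∈ T := by
  induction hx using Submodule.span_induction with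
  | mem x hx => exact hX x hx
  | zero => exact zero_mem T
  | add x y _ _ hx hy => exact add_mem hx hy
  | smul b x _ hx =>
    refine smul_mem_of_mem_adjoin T ?_ b.2 hx
    rintro _ ⟨p, q, a, rfl⟩ x hx
    exact hT p q a x hx

/-- The vectors in `S` which are mapped into `S` by all elements of a family. -/
def stabilized {κ : Type*} (S : Submodule ℂ M) (f : κ → A) : Submodule ℂ M where
  carrier := {x | x ∈ S ∧ ∀ k, f k • x ∈ S}
  zero_mem' := ⟨zero_mem S, fun k => by simp⟩
  add_mem' hx hy := ⟨add_mem hx.1 hy.1, fun k => by rw [smul_add]; exact add_mem (hx.2 k) (hy.2 k)⟩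
  smul_mem' z x hx := ⟨S.smul_mem z hx.1, fun k => by
    rw [smul_comm]; exact S.smul_mem z (hx.2 k)⟩

include he hφ hw

/-- The commutator of a lowering operator with a block element is again a lowering operator of the
last row, so it suffices to treat the generators, where `lower_smul_lowVec_mem` applies. -/
theorem lower_smul_mem_span_block {x : M}
    (hx : x ∈ Submodule.span (block e) (Set.range (lowVec φ w))) (j : Fin (r + 1)) (a : ℕ) :
    e (Fin.last _) j.castSucc a • x ∈ Submodule.span (block e) (Set.range (lowVec φ w)) := by
  set S := Submodule.span (block e) (Set.range (lowVec φ w)) with hS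
  have hv : ∀ s, lowVec φ w s ∈ S := fun s => Submodule.subset_span ⟨s, rfl⟩
  have h := mem_of_mem_span_block (stabilized (S.restrictScalars ℂ)
    fun k : Fin (r + 1) × ℕ => e (Fin.last _) k.1.castSucc k.2) ?_ ?_ hx
  · exact h.2 (j, a)
  · rintro _ ⟨s, rfl⟩
    exact ⟨hv s, fun k => lower_smul_lowVec_mem he hφ hw S _ _ _ (hv _)⟩
  · rintro p q a x ⟨h1, h2⟩
    refine ⟨smul_mem_of_mem_block S (mem_block e p q a) h1, fun k => ?_⟩
    rw [← mul_smul, he, add_smul, mul_smul, if_neg (Fin.castSucc_lt_last _).ne, sub_zero]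
    refine add_mem (smul_mem_of_mem_block S (mem_block e p q a) (h2 k)) ?_
    split_ifs
    · exact h2 (q, _)
    · simp

theorem map_smul_mem_span_block (P : MvPolynomial (Fin (r + 1)) ℂ) :
    φ P • w ∈ Submodule.span (block e) (Set.range (lowVec φ w)) := by
  induction P using MvPolynomial.induction_on with
  | C z =>
    rw [← MvPolynomial.algebraMap_eq, AlgHom.commutes, algebraMap_smul]
    exact csmul_mem _ _ (Submodule.subset_span ⟨0, by simp [lowVec]⟩)
  | add P Q hP hQ => rw [map_add, add_smul]; exact add_mem hP hQ
  | mul_X P i hP =>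
    rw [mul_comm, map_mul, hφ, mul_smul]
    exact lower_smul_mem_span_block he hφ hw hP i 0

theorem corner_smul_mem_span_block {x : M}
    (hx : x ∈ Submodule.span (block e) (Set.range (lowVec φ w))) (a : ℕ) :
    e (Fin.last _) (Fin.last _) a • x ∈ Submodule.span (block e) (Set.range (lowVec φ w)) := by
  set S := Submodule.span (block e) (Set.range (lowVec φ w)) with hS
  have hmap : ∀ P a, e (Fin.last _) (Fin.last _) a • φ P • w ∈ S := by
    intro P a
    induction P using MvPolynomial.induction_on with
    | C z =>
      rw [← MvPolynomial.algebraMap_eq, AlgHom.commutes, algebraMap_smul, smul_comm]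
      apply csmul_mem
      have hwS : w ∈ S := by simpa using map_smul_mem_span_block he hφ hw 1
      cases a with
      | zero => rw [hw.cartan_zero]; exact csmul_mem _ _ hwS
      | succ a => rw [hw.cartan_pos]; exact zero_mem S
    | add P Q hP hQ => rw [map_add, add_smul, smul_add]; exact add_mem hP hQ
    | mul_X P i hP =>
      rw [mul_comm, map_mul, hφ, mul_smul, ← mul_smul, he, add_smul, mul_smul, if_pos rfl,
        if_neg (Fin.castSucc_lt_last _).ne, sub_zero]
      exact add_mem (lower_smul_mem_span_block he hφ hw hP i 0)
        (lower_smul_mem_span_block he hφ hw (map_smul_mem_span_block he hφ hw P) i _)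
  have h := mem_of_mem_span_block (stabilized (S.restrictScalars ℂ)
    fun k : ℕ => e (Fin.last _) (Fin.last _) k) ?_ ?_ hx
  · exact h.2 a
  · rintro _ ⟨s, rfl⟩
    exact ⟨Submodule.subset_span ⟨s, rfl⟩, fun k => hmap _ k⟩
  · rintro p q a x ⟨h1, h2⟩
    refine ⟨smul_mem_of_mem_block S (mem_block e p q a) h1, fun k => ?_⟩
    rw [← mul_smul, (he.commute (Fin.castSucc_lt_last _).ne' (Fin.castSucc_lt_last _).ne _ _).eq,
      mul_smul]
    exact smul_mem_of_mem_block S (mem_block e p q a) (h2 k)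

theorem raise_smul_mem_span_block {x : M}
    (hx : x ∈ Submodule.span (block e) (Set.range (lowVec φ w))) (j : Fin (r + 1)) (a : ℕ) :
    e j.castSucc (Fin.last _) a • x ∈ Submodule.span (block e) (Set.range (lowVec φ w)) := by
  set S := Submodule.span (block e) (Set.range (lowVec φ w)) with hS
  have hmap : ∀ P (j : Fin (r + 1)) (a : ℕ), e j.castSucc (Fin.last _) a • φ P • w ∈ S := by
    intro P j a
    induction P using MvPolynomial.induction_on with
    | C z =>
      rw [← MvPolynomial.algebraMap_eq, AlgHom.commutes, algebraMap_smul, smul_comm,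
        hw.raising _ _ _ (Fin.castSucc_lt_last _), smul_zero]
      exact zero_mem S
    | add P Q hP hQ => rw [map_add, add_smul, smul_add]; exact add_mem hP hQ
    | mul_X P i hP =>
      have hPS := map_smul_mem_span_block he hφ hw P
      rw [mul_comm, map_mul, hφ, mul_smul, ← mul_smul, he, add_smul, mul_smul, if_pos rfl, sub_smul]
      refine add_mem (lower_smul_mem_span_block he hφ hw hP i 0) (sub_mem
        (smul_mem_of_mem_block S (mem_block e _ _ _) hPS) ?_)
      split_ifs
      · exact corner_smul_mem_span_block he hφ hw hPS _
      · simp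
  have h := mem_of_mem_span_block (stabilized (S.restrictScalars ℂ)
    fun k : Fin (r + 1) × ℕ => e k.1.castSucc (Fin.last _) k.2) ?_ ?_ hx
  · exact h.2 (j, a)
  · rintro _ ⟨s, rfl⟩
    exact ⟨Submodule.subset_span ⟨s, rfl⟩, fun k => hmap _ _ _⟩
  · rintro p q a x ⟨h1, h2⟩
    refine ⟨smul_mem_of_mem_block S (mem_block e p q a) h1, fun k => ?_⟩
    rw [← mul_smul, he, add_smul, mul_smul, if_neg (Fin.castSucc_lt_last _).ne', zero_sub]
    refine add_mem (smul_mem_of_mem_block S (mem_block e p q a) (h2 k)) ?_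
    split_ifs
    · rw [neg_smul]
      exact neg_mem (h2 (p, _))
    · simp

/-- The vectors `lowVec φ w s` generate the module generated by `w` over the block. -/
theorem mem_of_lowVec_mem (hgen : Algebra.adjoin ℂ {x | ∃ p q a, x = e p q a} = ⊤)
    (N : Submodule (block e) M) (hN : ∀ s, lowVec φ w s ∈ N) {x : M}
    (hx : x ∈ Submodule.span A {w}) : x ∈ N := by
  set S := Submodule.span (block e) (Set.range (lowVec φ w)) with hS
  have hSN : S ≤ N := Submodule.span_le.mpr (by rintro _ ⟨s, rfl⟩; exact hN s)
  obtain ⟨b, rfl⟩ := Submodule.mem_span_singleton.mp hx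
  refine hSN (smul_mem_of_mem_adjoin (X := {x | ∃ p q a, x = e p q a}) (S.restrictScalars ℂ) ?_
    (by rw [hgen]; trivial) (by simpa using map_smul_mem_span_block he hφ hw 1))
  rintro _ ⟨p, q, a, rfl⟩ x hx
  induction p using Fin.lastCases with
  | last =>
    induction q using Fin.lastCases with
    | last => exact corner_smul_mem_span_block he hφ hw hx a
    | cast q => exact lower_smul_mem_span_block he hφ hw hx q a
  | cast p =>
    induction q using Fin.lastCases with
    | last => exact raise_smul_mem_span_block he hφ hw hx p a
    | cast q => exact smul_mem_of_mem_block S (mem_block e p q a) hx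

end Spanning

/-! ### Counting dimensions: the upper bound by induction on the rank. -/

section Layer

universe u v

variable {B : Type u} {M : Type v} [Ring B] [Algebra ℂ B] [AddCommGroup M] [Module ℂ M]
  [Module B M] [IsScalarTower ℂ B M]

theorem rank_sup_span_le (N : Submodule B M) (x : M) (d : Cardinal)
    (h : Module.rank ℂ (Submodule.span B {N.mkQ x}) ≤ d) :
    Module.rank ℂ (N ⊔ Submodule.span B {x} : Submodule B M) ≤ Module.rank ℂ N + d := by
  set T := N ⊔ Submodule.span B {x} with hT
  let f : T →ₗ[ℂ] M ⧸ N := (N.mkQ.comp T.subtype).restrictScalars ℂ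
  rw [← LinearMap.rank_range_add_rank_ker f, add_comm]
  refine add_le_add ?_ (le_trans ?_ h)
  · let g : LinearMap.ker f →ₗ[ℂ] N :=
      { toFun := fun y => ⟨(y : T), by
          have := y.2
          rw [LinearMap.mem_ker] at this
          simpa [f] using this⟩
        map_add' := fun _ _ => rfl
        map_smul' := fun _ _ => rfl }
    refine LinearMap.rank_le_of_injective g fun y z hyz => ?_
    have := congrArg Subtype.val hyz
    exact Subtype.ext (Subtype.ext this)
  · have hle : LinearMap.range f ≤ (Submodule.span B {N.mkQ x}).restrictScalars ℂ := by
      rintro _ ⟨⟨y, hy⟩, rfl⟩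
      obtain ⟨a, ha, b, hb, rfl⟩ := Submodule.mem_sup.mp hy
      obtain ⟨b, rfl⟩ := Submodule.mem_span_singleton.mp hb
      have : f ⟨a + b • x, hy⟩ = b • N.mkQ x := by
        simp [f, (Submodule.Quotient.mk_eq_zero N).mpr ha]
      rw [this]
      exact Submodule.smul_mem _ _ (Submodule.mem_span_singleton_self _)
    exact Submodule.rank_mono hle

/-- Each step of the chain adjoins `ψ b • v`, which the `ψ (p i)` send into the submodule already
built, at a cost of at most `d` dimensions. The bound `hd` is required for all larger submodules
because later steps are taken modulo the earlier ones. -/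
theorem exists_layer {ι D : Type*} [CommRing D] [Algebra ℂ D] {p : ι → D} {I : Ideal D} {K : ℕ}
    (hR : Reach p I K) (ψ : D →ₐ[ℂ] B) (v : M) (d : ℕ) (N : Submodule B M)
    (hI : ∀ P ∈ I, ψ P • v ∈ N)
    (hd : ∀ N', N ≤ N' → ∀ P, (∀ i, ψ (p i * P) • v ∈ N') →
      Module.rank ℂ (Submodule.span B {N'.mkQ (ψ P • v)}) ≤ d) :
    ∃ N', N ≤ N' ∧ v ∈ N' ∧ Module.rank ℂ N' ≤ Module.rank ℂ N + (K * d : ℕ) := by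
  induction hR generalizing N with
  | top => exact ⟨N, le_rfl, by simpa using hI 1 trivial, by simp⟩
  | step I b K hb _ ih =>
    have h1 := rank_sup_span_le N (ψ b • v) d (hd N le_rfl b fun i => hI _ (hb i))
    obtain ⟨N', h2, h3, h4⟩ := ih (N ⊔ Submodule.span B {ψ b • v}) (by
      intro P hP
      obtain ⟨y, hy, z, hz, rfl⟩ := Submodule.mem_sup.mp hP
      obtain ⟨a, rfl⟩ := Ideal.mem_span_singleton'.mp hz
      rw [map_add, add_smul, map_mul, mul_smul]
      exact add_mem (Submodule.mem_sup_left (hI y hy)) (Submodule.smul_mem _ _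
        (Submodule.mem_sup_right (Submodule.mem_span_singleton_self _))))
      (fun N' hN' => hd N' (le_sup_left.trans hN'))
    refine ⟨N', le_sup_left.trans h2, h3, h4.trans ((add_le_add_left h1 _).trans ?_)⟩
    rw [add_assoc]
    apply le_of_eq
    push_cast
    ring

end Layer

/-- The branching identity for the dimensions. -/
theorem sum_box_eq_prod (r : ℕ) (m : Fin (r + 1) → ℕ) :
    ∑ s ∈ Fintype.piFinset (fun i => Finset.range (m i + 1)), (∏ i, (m i).choose (s i)) *
      ∏ i : Fin r, (r + 1).choose (i + 1) ^ (m i.castSucc - s i.castSucc + s i.succ) =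
    ∏ i : Fin (r + 1), (r + 1 + 1).choose (i + 1) ^ m i := by
  have h : ∀ i : Fin (r + 1), (r + 1 + 1).choose ((i : ℕ) + 1) ^ m i =
      ∑ k ∈ Finset.range (m i + 1), (r + 1).choose i ^ k * (r + 1).choose (i + 1) ^ (m i - k) *
        (m i).choose k := by
    intro i
    rw [Nat.choose_succ_succ, add_pow]
    simp
  simp only [h]
  rw [Finset.prod_univ_sum]
  refine Finset.sum_congr rfl fun s _ => ?_
  rw [Finset.prod_mul_distrib, Finset.prod_mul_distrib, mul_comm]
  congr 1
  -- The factors `(r + 1).choose 0` and `(r + 1).choose (r + 1)` split off here are `1`; the shift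
  -- of index left between the two products produces the exponent `m_i - s_i + s_{i+1}`.
  rw [Fin.prod_univ_succ (fun i : Fin (r + 1) => (r + 1).choose i ^ s i),
    Fin.prod_univ_castSucc (fun i : Fin (r + 1) => (r + 1).choose (i + 1) ^ (m i - s i))]
  simp [pow_add, Finset.prod_mul_distrib, mul_comm]

universe u v

/-- The upper bound for the dimension of a module generated by a highest weight vector. -/
theorem rank_span_singleton_le (r : ℕ) : ∀ (A : Type u) (M : Type v) [Ring A] [Algebra ℂ A]
    [AddCommGroup M] [Module ℂ M] [Module A M] [IsScalarTower ℂ A M]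
    (e : Fin (r + 1) → Fin (r + 1) → ℕ → A), IsCurrentGL e →
    Algebra.adjoin ℂ {x | ∃ p q a, x = e p q a} = ⊤ →
    (∀ (i : Fin r) (x : M), ∃ k, e i.succ i.castSucc 0 ^ k • x = 0) →
    ∀ (c : Fin (r + 1) → ℂ) (m : Fin r → ℕ), (∀ i : Fin r, c i.castSucc - c i.succ = m i) →
    ∀ w : M, IsHighestWeight e c w → Module.rank ℂ (Submodule.span A {w}) ≤
      (∏ i : Fin r, (r + 1).choose (i + 1) ^ m i : ℕ) := by
  induction r with
  | zero =>
    intro A M _ _ _ _ _ _ e he hgen _ c m _ w hw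
    -- In rank zero the only generators are diagonal and preserve the line through `w`.
    have hle : (Submodule.span A {w}).restrictScalars ℂ ≤ Submodule.span ℂ {w} := by
      intro x hx
      obtain ⟨b, rfl⟩ := Submodule.mem_span_singleton.mp (show x ∈ Submodule.span A {w} from hx)
      refine smul_mem_of_mem_adjoin (X := {x | ∃ p q a, x = e p q a}) _ ?_
        (by rw [hgen]; trivial) (Submodule.mem_span_singleton_self w)
      rintro _ ⟨p, q, a, rfl⟩ x hx
      obtain ⟨z, rfl⟩ := Submodule.mem_span_singleton.mp hx
      rw [smul_comm, show q = p from Fin.ext (by omega)]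
      refine Submodule.smul_mem _ _ ?_
      cases a with
      | zero => rw [hw.cartan_zero]; exact Submodule.smul_mem _ _ (Submodule.mem_span_singleton_self w)
      | succ a => rw [hw.cartan_pos]; exact zero_mem _
    refine (Submodule.rank_mono hle).trans ((rank_span_le _).trans ?_)
    simp
  | succ r ih =>
    intro A M _ _ _ _ _ _ e he hgen hnil c m hc w hw
    obtain ⟨φ, hφ⟩ := exists_algHom_of_commute
      (fun i : Fin (r + 1) => e (Fin.last _) i.castSucc 0)
      (fun i j => he.commute (Fin.castSucc_lt_last _).ne (Fin.castSucc_lt_last _).ne _ _)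
    obtain ⟨ψ, hψ'⟩ := exists_algHom_of_commute
      (fun i : Fin (r + 1) × ℕ => -e i.1.castSucc i.1.castSucc (i.2 + 1))
      (fun i j => (he.commute_diag _ _ _ _).neg_left.neg_right)
    have hψ : ∀ i k, ψ (psum i k) = -e i.castSucc i.castSucc (k + 1) := fun i k => hψ' (i, k)
    have hm : ∀ i : Fin (r + 1), e i.succ i.castSucc 0 ^ (m i + 1) • w = 0 := fun i =>
      lowering_pow_smul_eq_zero he Fin.castSucc_lt_succ.ne
        (hw.raising _ _ 0 Fin.castSucc_lt_succ) (hw.cartan_zero _) (hw.cartan_zero _) (hc i)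
        (hnil i w)
    set v := lowVec φ w with hv
    let d : (Fin (r + 1) → ℕ) → ℕ := fun s =>
      ∏ i : Fin r, (r + 1).choose (i + 1) ^ (m i.castSucc - s i.castSucc + s i.succ)
    let K : (Fin (r + 1) → ℕ) → ℕ := fun s => ∏ i, (m i).choose (s i)
    let ψB : PowerSums (r + 1) →ₐ[ℂ] block e := ψ.codRestrict (block e) (map_mem_block hψ)
    have hψB : ∀ P (x : M), ψB P • x = ψ P • x := fun P x => rfl
    have hlayer : ∀ s : Fin (r + 1) →₀ ℕ, (∀ i, s i ≤ m i) → ∀ N : Submodule (block e) M,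
        (∀ t, ht t < ht s → v t ∈ N) → ∃ N', N ≤ N' ∧ v s ∈ N' ∧
          Module.rank ℂ N' ≤ Module.rank ℂ N + (K s * d s : ℕ) := by
      intro s hs N hN
      refine exists_layer (reach_boxIdeal m s) ψB (v s) (d s) N
        (fun P hP => boxIdeal_smul_mem he hφ hw hψ hm N s hN P hP) ?_
      intro N' hN' P hP
      let e' : Fin (r + 1) → Fin (r + 1) → ℕ → block e :=
        fun p q a => ⟨e p.castSucc q.castSucc a, mem_block e p q a⟩
      have he' : IsCurrentGL e' := by
        intro p q p' q' a b
        apply Subtype.ext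
        have := he p.castSucc q.castSucc p'.castSucc q'.castSucc a b
        simp only [Fin.castSucc_inj] at this
        simp only [e', Subalgebra.coe_mul, Subalgebra.coe_add, Subalgebra.coe_sub, this]
        split_ifs <;> rfl
      have hgen' : Algebra.adjoin ℂ {x | ∃ p q a, x = e' p q a} = ⊤ := by
        refine Eq.trans (congrArg (Algebra.adjoin ℂ) ?_) (Algebra.adjoin_adjoin_coe_preimage (R := ℂ)
          (s := {x | ∃ (p q : Fin (r + 1)) (a : ℕ), x = e p.castSucc q.castSucc a}))
        ext x
        exact exists_congr fun p => exists_congr fun q => exists_congr fun a => Subtype.ext_iff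
      -- In `M ⧸ N'` the class of `ψ P • v s` is a highest weight vector for the block. The
      -- truncated subtraction in its weight is a genuine one because `s i ≤ m i`.
      refine ih (block e) (M ⧸ N') e' he' hgen' ?_ (fun p => c p.castSucc - s p)
        (fun i => m i.castSucc - s i.castSucc + s i.succ) ?_ (N'.mkQ (ψB P • v s)) ?_
      · intro i x
        obtain ⟨x, rfl⟩ := N'.mkQ_surjective x
        obtain ⟨k, hk⟩ := hnil i.castSucc x
        refine ⟨k, ?_⟩
        rw [← map_smul]
        have : (e' i.succ i.castSucc 0 ^ k) • x = 0 := hk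
        rw [this, map_zero]
      · intro i
        have := hc i.castSucc
        rw [Nat.cast_add, Nat.cast_sub (hs _), ← this, Fin.succ_castSucc]
        ring
      · refine ⟨fun p q a hpq => ?_, fun p a => ?_, fun p => ?_⟩
        · rw [← map_smul, Submodule.mkQ_apply, Submodule.Quotient.mk_eq_zero]
          exact raising_smul_mem he hφ hw hψ N' s (fun t ht => hN' (hN t ht)) p q hpq a P
        · rw [← map_smul, Submodule.mkQ_apply, Submodule.Quotient.mk_eq_zero]
          have := hP (p, a)
          rw [hψB, map_mul, hψ, neg_mul, neg_smul, neg_mem_iff, mul_smul] at this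
          exact this
        · have : e' p p 0 • ψB P • v s = (c p.castSucc - s p) • ψB P • v s := by
            show e p.castSucc p.castSucc 0 • ψ P • v s = _ • ψ P • v s
            rw [← mul_smul, (diag_commute_map he hψ p P 0).eq, mul_smul, hv,
              diag_zero_smul_lowVec he hφ hw, smul_comm]
          rw [← map_smul, this]
          exact LinearMap.map_smul_of_tower N'.mkQ _ _
    -- Outside the box the ideal is the whole ring, so these monomials contribute no new dimension.
    have hout : ∀ s : Fin (r + 1) →₀ ℕ, ¬ (∀ i, s i ≤ m i) → ∀ N : Submodule (block e) M,
        (∀ t, ht t < ht s → v t ∈ N) → v s ∈ N := by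
      intro s hs N hN
      push Not at hs
      obtain ⟨i, hi⟩ := hs
      have := boxIdeal_smul_mem he hφ hw hψ hm N s hN 1 (by rw [boxIdeal_eq_top i hi]; trivial)
      simpa using this
    let box : Finset (Fin (r + 1) →₀ ℕ) :=
      (Fintype.piFinset (fun i => Finset.range (m i + 1))).map
        Finsupp.equivFunOnFinite.symm.toEmbedding
    have hbox : ∀ s, s ∈ box ↔ ∀ i, s i ≤ m i := by
      intro s
      simp only [box, Finset.mem_map_equiv, Equiv.symm_symm, Fintype.mem_piFinset,
        Finset.mem_range, Finsupp.equivFunOnFinite_apply, Nat.lt_succ_iff]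
    have hfilt : ∀ n, ∃ N : Submodule (block e) M, (∀ s, ht s < n → v s ∈ N) ∧
        Module.rank ℂ N ≤ (∑ s ∈ box with ht s < n, K s * d s : ℕ) := by
      intro n
      induction n with
      | zero => exact ⟨⊥, by simp, by simp⟩
      | succ n ihn =>
        obtain ⟨N, hN, hrank⟩ := ihn
        -- Monomials of equal height are adjoined one at a time, in any order, since `hlayer` asks
        -- only for those of smaller height.
        have hstep : ∀ T ⊆ box.filter (fun s => ht s = n), ∃ N' : Submodule (block e) M, N ≤ N' ∧
            (∀ s ∈ T, v s ∈ N') ∧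
            Module.rank ℂ N' ≤ (∑ s ∈ box with ht s < n, K s * d s + ∑ s ∈ T, K s * d s : ℕ) := by
          intro T
          induction T using Finset.induction_on with
          | empty => exact fun _ => ⟨N, le_rfl, by simp, by simpa using hrank⟩
          | insert s T hsT ihT =>
            intro hT
            rw [Finset.insert_subset_iff, Finset.mem_filter] at hT
            obtain ⟨N₁, h1, h2, h3⟩ := ihT hT.2
            obtain ⟨N₂, h4, h5, h6⟩ := hlayer s ((hbox s).mp hT.1.1) N₁
              (fun t htt => h1 (hN t (by rw [← hT.1.2]; exact htt)))
            refine ⟨N₂, h1.trans h4, ?_, h6.trans ((add_le_add_left h3 _).trans ?_)⟩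
            · intro t htT
              rcases Finset.mem_insert.mp htT with rfl | htT
              · exact h5
              · exact h4 (h2 t htT)
            · rw [Finset.sum_insert hsT, ← Nat.cast_add]
              exact Nat.cast_le.mpr (by omega)
        obtain ⟨N', h1, h2, h3⟩ := hstep _ subset_rfl
        refine ⟨N', fun s hs => ?_, h3.trans (Nat.cast_le.mpr (le_of_eq ?_))⟩
        · rcases Nat.lt_succ_iff_lt_or_eq.mp hs with h | h
          · exact h1 (hN s h)
          · by_cases hsb : ∀ i, s i ≤ m i
            · exact h2 s (Finset.mem_filter.mpr ⟨(hbox s).mpr hsb, h⟩)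
            · exact hout s hsb N' fun t htt => h1 (hN t (by omega))
        · rw [← Finset.sum_union]
          · congr 1
            ext s
            simp only [Finset.mem_union, Finset.mem_filter]
            have : ht s < n + 1 ↔ ht s < n ∨ ht s = n := Nat.lt_succ_iff_lt_or_eq
            tauto
          · rw [Finset.disjoint_filter]
            intro s _ h h'
            omega
    -- This bound exceeds every height in the box, so all box monomials are in `N`; the others
    -- follow by induction on the height.
    obtain ⟨N, hN, hrank⟩ := hfilt (box.sup ht + 1)
    have hall : ∀ s, v s ∈ N := by
      intro s
      induction hn : ht s using Nat.strong_induction_on generalizing s with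
      | _ n ihn =>
        subst hn
        by_cases hsb : ∀ i, s i ≤ m i
        · exact hN s (Nat.lt_succ_of_le (Finset.le_sup (f := ht) ((hbox s).mpr hsb)))
        · exact hout s hsb N fun t htt => ihn _ htt t rfl
    have hle : (Submodule.span A {w}).restrictScalars ℂ ≤ N.restrictScalars ℂ := fun x hx =>
      mem_of_lowVec_mem he hφ hw hgen N hall hx
    refine (Submodule.rank_mono hle).trans (hrank.trans (Nat.cast_le.mpr ?_))
    rw [← sum_box_eq_prod]
    refine (Finset.sum_le_sum_of_subset (Finset.filter_subset _ _)).trans (le_of_eq ?_)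
    rw [Finset.sum_map]
    rfl

-- The Weyl module as an instance of the upper bound.

attribute [local instance] LieRing.ofAssociativeRing

theorem cur_mul_cur {r : ℕ} (f f' : ℂ[X]) (x y : g r) :
    cur f x * cur f' y = cur f' y * cur f x + cur (f * f') ⁅x, y⁆ := by
  have h : cur (f * f') ⁅x, y⁆ = cur f x * cur f' y - cur f' y * cur f x := by
    rw [cur, ← LieAlgebra.ExtendScalars.bracket_tmul, LieHom.map_lie,
      LieRing.of_associative_ring_bracket]
    rfl
  rw [h]
  abel

theorem cur_smul_left {r : ℕ} (c : ℂ) (f : ℂ[X]) (x : g r) : cur (c • f) x = c • cur f x := by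
  rw [cur, ← TensorProduct.smul_tmul', map_smul]; rfl

theorem cur_add_left {r : ℕ} (f f' : ℂ[X]) (x : g r) : cur (f + f') x = cur f x + cur f' x := by
  rw [cur, TensorProduct.add_tmul, map_add]; rfl

theorem cur_smul_right {r : ℕ} (c : ℂ) (f : ℂ[X]) (x : g r) : cur f (c • x) = c • cur f x := by
  rw [cur, TensorProduct.tmul_smul, map_smul]; rfl

theorem cur_add_right {r : ℕ} (f : ℂ[X]) (x y : g r) : cur f (x + y) = cur f x + cur f y := by
  rw [cur, TensorProduct.tmul_add, map_add]; rfl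

theorem cur_zero_right {r : ℕ} (f : ℂ[X]) : cur f (0 : g r) = 0 := by
  rw [cur, TensorProduct.tmul_zero, map_zero]

theorem cur_sub_right {r : ℕ} (f : ℂ[X]) (x y : g r) : cur f (x - y) = cur f x - cur f y := by
  rw [cur, TensorProduct.tmul_sub, map_sub]; rfl

/-- The projection of `𝔤𝔩_{r+1}` onto `𝔰𝔩_{r+1}` along the scalar matrices. -/
def slProj (r : ℕ) : Matrix (Fin (r + 1)) (Fin (r + 1)) ℂ →ₗ[ℂ] g r where
  toFun x := ⟨x - (((r : ℂ) + 1)⁻¹ * x.trace) • 1, by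
    have hr : (r : ℂ) + 1 ≠ 0 := Nat.cast_add_one_ne_zero r
    change Matrix.trace (x - (((r : ℂ) + 1)⁻¹ * x.trace) • 1) = 0
    rw [Matrix.trace_sub, Matrix.trace_smul, Matrix.trace_one, Fintype.card_fin, smul_eq_mul]
    push_cast
    field_simp
    simp⟩
  map_add' x y := by
    apply Subtype.ext
    change x + y - (((r : ℂ) + 1)⁻¹ * (x + y).trace) • 1 = (x - (((r : ℂ) + 1)⁻¹ * x.trace) • 1) +
      (y - (((r : ℂ) + 1)⁻¹ * y.trace) • 1)
    rw [Matrix.trace_add]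
    module
  map_smul' c x := by
    apply Subtype.ext
    change c • x - (((r : ℂ) + 1)⁻¹ * (c • x).trace) • 1 = c • (x - (((r : ℂ) + 1)⁻¹ * x.trace) • 1)
    rw [Matrix.trace_smul, smul_eq_mul]
    module

theorem slProj_val {r : ℕ} (x : g r) :
    slProj r (x : Matrix (Fin (r + 1)) (Fin (r + 1)) ℂ) = x := by
  have h : Matrix.trace (x : Matrix (Fin (r + 1)) (Fin (r + 1)) ℂ) = 0 := x.2
  apply Subtype.ext
  simp [slProj, h]

/-- Scalar matrices are central and commutators are traceless. Hence the projected matrix units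
satisfy the relations of `𝔤𝔩` inside the enveloping algebra of the current algebra of `𝔰𝔩`. -/
theorem lie_slProj {r : ℕ} (x y : Matrix (Fin (r + 1)) (Fin (r + 1)) ℂ) :
    ⁅slProj r x, slProj r y⁆ = slProj r (x * y - y * x) := by
  apply Subtype.ext
  rw [LieAlgebra.SpecialLinear.sl_bracket]
  have h : (x * y - y * x).trace = 0 := by rw [Matrix.trace_sub, Matrix.trace_mul_comm, sub_self]
  simp only [slProj, LinearMap.coe_mk, AddHom.coe_mk, h, mul_zero, zero_smul, sub_zero]
  simp only [sub_mul, mul_sub, smul_mul_assoc, mul_smul_comm, one_mul, mul_one]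
  module

theorem slProj_single {r : ℕ} {p q : Fin (r + 1)} (h : p ≠ q) :
    slProj r (Matrix.single p q 1) = E r p q h := by
  rw [← slProj_val (E r p q h)]
  rfl

/-- The element `E_{p,q} ⊗ t^a`, projected to the current algebra of `𝔰𝔩_{r+1}`. -/
def curUnit (r : ℕ) (p q : Fin (r + 1)) (a : ℕ) : UCurrent r :=
  cur (Polynomial.X ^ a) (slProj r (Matrix.single p q 1))

theorem isCurrentGL_curUnit (r : ℕ) : IsCurrentGL (curUnit r) := by
  intro p q p' q' a b
  rw [curUnit, curUnit, cur_mul_cur, lie_slProj, ← pow_add, map_sub, cur_sub_right]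
  have h : ∀ p q p' q' : Fin (r + 1), cur (Polynomial.X ^ (a + b)) (slProj r
      (Matrix.single p q 1 * Matrix.single p' q' 1)) =
        if q = p' then curUnit r p q' (a + b) else 0 := by
    intro p q p' q'
    split_ifs with h
    · subst h
      rw [Matrix.single_mul_single_same, one_mul]
      rfl
    · rw [Matrix.single_mul_single_of_ne _ _ _ _ h, map_zero, cur_zero_right]
  rw [h, h]

theorem adjoin_range_ι (L : Type*) [LieRing L] [LieAlgebra ℂ L] :
    Algebra.adjoin ℂ (Set.range (UniversalEnvelopingAlgebra.ι ℂ (L := L))) = ⊤ := by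
  rw [eq_top_iff]
  rintro x -
  obtain ⟨y, rfl⟩ : ∃ y, UniversalEnvelopingAlgebra.mkAlgHom ℂ L y = x := by
    exact RingCon.mk'_surjective _ x
  induction y using TensorAlgebra.induction with
  | algebraMap c => rw [AlgHom.commutes]; exact Subalgebra.algebraMap_mem _ c
  | ι x => exact Algebra.subset_adjoin ⟨x, rfl⟩
  | mul a b ha hb => rw [map_mul]; exact mul_mem ha hb
  | add a b ha hb => rw [map_add]; exact add_mem ha hb

theorem adjoin_curUnit (r : ℕ) :
    Algebra.adjoin ℂ {x | ∃ p q a, x = curUnit r p q a} = ⊤ := by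
  rw [eq_top_iff, ← adjoin_range_ι]
  refine Algebra.adjoin_le ?_
  rintro _ ⟨z, rfl⟩
  set S := Algebra.adjoin ℂ {x | ∃ p q a, x = curUnit r p q a} with hS
  have h1 : ∀ (a : ℕ) (x : Matrix (Fin (r + 1)) (Fin (r + 1)) ℂ),
      cur (Polynomial.X ^ a) (slProj r x) ∈ S := by
    intro a x
    induction x using Matrix.induction_on' with
    | h_zero => rw [map_zero, cur_zero_right]; exact zero_mem S
    | h_add x y hx hy => rw [map_add, cur_add_right]; exact add_mem hx hy
    | h_std_basis p q c =>
      rw [show Matrix.single p q c = c • Matrix.single p q 1 by simp, map_smul, cur_smul_right]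
      exact S.smul_mem (Algebra.subset_adjoin ⟨p, q, a, rfl⟩) c
  have h2 : ∀ (f : ℂ[X]) (x : g r), cur f x ∈ S := by
    intro f x
    induction f using Polynomial.induction_on' with
    | add f f' hf hf' => rw [cur_add_left]; exact add_mem hf hf'
    | monomial a c =>
      rw [← Polynomial.smul_X_eq_monomial, cur_smul_left, ← slProj_val x]
      exact S.smul_mem (h1 a _) c
  induction z using TensorProduct.induction_on with
  | zero => rw [map_zero]; exact zero_mem S
  | tmul f x => exact h2 f x
  | add x y hx hy =>
    rw [map_add]
    exact add_mem hx hy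

section Nilpotent

variable {A M : Type*} [Ring A] [AddCommGroup M] [Module A M]

/-- This reduces stability of the `f`-nilpotent vectors under `b` to stability under the commutator
of `f` with `b`. As a simple lowering matrix has square zero, its third iterated commutator
vanishes, and three applications give local nilpotency on the Weyl module. -/
theorem exists_pow_smul_eq_zero_of_commutator {f b b' : A} (h : f * b = b * f + b')
    (hb' : ∀ x : M, (∃ k, f ^ k • x = 0) → ∃ k, f ^ k • b' • x = 0) (x : M)
    (hx : ∃ k, f ^ k • x = 0) : ∃ k, f ^ k • b • x = 0 := by
  obtain ⟨k, hk⟩ := hx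
  induction k generalizing x with
  | zero => exact ⟨0, by rw [pow_zero, one_smul] at hk ⊢; rw [hk, smul_zero]⟩
  | succ k ih =>
    obtain ⟨k₁, h₁⟩ := ih (f • x) (by rwa [← mul_smul, ← pow_succ])
    obtain ⟨k₂, h₂⟩ := hb' x ⟨k + 1, hk⟩
    refine ⟨k₁ + k₂ + 1, ?_⟩
    rw [pow_succ, mul_smul, ← mul_smul f, h, add_smul, smul_add, mul_smul b]
    nth_rewrite 1 [add_comm k₁ k₂]
    rw [pow_add, pow_add, mul_smul, mul_smul, h₁, h₂, smul_zero, smul_zero, add_zero]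

end Nilpotent

variable {r : ℕ}

theorem triple_lie_eq_zero (f x : g r)
    (hf : (f : Matrix (Fin (r + 1)) (Fin (r + 1)) ℂ) * (f : Matrix _ _ ℂ) = 0) :
    ⁅f, ⁅f, ⁅f, x⁆⁆⁆ = 0 := by
  apply Subtype.ext
  simp only [LieAlgebra.SpecialLinear.sl_bracket, ZeroMemClass.coe_zero]
  set F : Matrix (Fin (r + 1)) (Fin (r + 1)) ℂ := f.val
  set Y : Matrix (Fin (r + 1)) (Fin (r + 1)) ℂ := x.val
  have h1 : F * (F * Y) = 0 := by rw [← mul_assoc, hf, zero_mul]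
  have h2 : Y * F * F = 0 := by rw [mul_assoc, hf, mul_zero]
  simp only [mul_sub, sub_mul, mul_assoc] at *
  simp [h1, hf]
  simp [← mul_assoc, hf]

variable (m : Fin r → ℕ)

/-- The generator `w_λ`. -/
def weylGen : WeylModule m := (relations m).mkQ 1

theorem smul_weylGen (u : UCurrent r) : u • weylGen m = (relations m).mkQ u := by
  rw [weylGen, ← map_smul, smul_eq_mul, mul_one]

theorem span_weylGen : Submodule.span (UCurrent r) {weylGen m} = ⊤ := by
  rw [eq_top_iff]
  rintro x -
  obtain ⟨u, rfl⟩ := (relations m).mkQ_surjective x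
  exact Submodule.mem_span_singleton.mpr ⟨u, smul_weylGen m u⟩

variable {m} in
theorem Relator.smul_weylGen {u : UCurrent r} (h : Relator m u) : u • weylGen m = 0 := by
  rw [CurrentWeyl.smul_weylGen, Submodule.mkQ_apply, Submodule.Quotient.mk_eq_zero]
  exact Submodule.subset_span h

theorem curUnit_lowering (i : Fin r) : curUnit r i.succ i.castSucc 0 = cur 1 (xMinus r i) := by
  rw [curUnit, pow_zero, slProj_single (ne_of_gt Fin.castSucc_lt_succ)]
  rfl

theorem exists_lowering_pow_smul_eq_zero (i : Fin r) (x : WeylModule m) :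
    ∃ k, curUnit r i.succ i.castSucc 0 ^ k • x = 0 := by
  rw [curUnit_lowering]
  have hf : (xMinus r i : Matrix (Fin (r + 1)) (Fin (r + 1)) ℂ) * (xMinus r i : Matrix _ _ ℂ) = 0 :=
    Matrix.single_mul_single_of_ne _ _ _ _ Fin.castSucc_lt_succ.ne _
  have key : ∀ (f : ℂ[X]) (y : g r) (x : WeylModule m), (∃ k, cur 1 (xMinus r i) ^ k • x = 0) →
      ∃ k, cur 1 (xMinus r i) ^ k • cur f y • x = 0 := by
    intro f y
    have hc : ∀ z, cur 1 (xMinus r i) * cur f z = cur f z * cur 1 (xMinus r i) +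
        cur f ⁅xMinus r i, z⁆ := fun z => by rw [cur_mul_cur, one_mul]
    refine exists_pow_smul_eq_zero_of_commutator (hc y)
      (exists_pow_smul_eq_zero_of_commutator (hc _) (exists_pow_smul_eq_zero_of_commutator (hc _) ?_))
    intro x _
    exact ⟨0, by rw [triple_lie_eq_zero _ _ hf, cur_zero_right, zero_smul, smul_zero]⟩
  let T : Submodule ℂ (WeylModule m) :=
    { carrier := {x | ∃ k, cur 1 (xMinus r i) ^ k • x = 0}
      zero_mem' := ⟨0, by simp⟩
      add_mem' := by
        rintro x y ⟨k, hk⟩ ⟨l, hl⟩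
        refine ⟨k + l, ?_⟩
        rw [smul_add]
        nth_rewrite 1 [add_comm k l]
        rw [pow_add, pow_add, mul_smul, mul_smul, hk, hl, smul_zero, smul_zero, add_zero]
      smul_mem' := by
        rintro c x ⟨k, hk⟩
        exact ⟨k, by rw [smul_comm, hk, smul_zero]⟩ }
  have hx : x ∈ Submodule.span (UCurrent r) {weylGen m} := by rw [span_weylGen]; trivial
  obtain ⟨u, rfl⟩ := Submodule.mem_span_singleton.mp hx
  refine smul_mem_of_mem_adjoin (X := {x | ∃ p q a, x = curUnit r p q a}) T ?_
    (by rw [adjoin_curUnit]; trivial) ⟨m i + 1, (Relator.lowering i).smul_weylGen⟩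
  rintro _ ⟨p, q, a, rfl⟩ x hx
  exact key _ _ x hx

theorem slProj_diag_mem_cartan (p : Fin (r + 1)) : slProj r (Matrix.single p p 1) ∈ cartan r := by
  intro a b hab
  have : Matrix.single p p (1 : ℂ) a b = 0 := by
    apply Matrix.single_apply_of_ne
    rintro ⟨rfl, rfl⟩
    exact hab rfl
  simp [slProj, this, hab]

theorem weight_coroot (i : Fin r) : weight m ⟨coroot r i, coroot_mem_cartan r i⟩ = m i := by
  simp [weight, LinearMap.sum_apply, fundamentalWeight_coroot]

/-- The value of the weight at the traceless part of `E_{p,p}`. -/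
def diagWeight (p : Fin (r + 1)) : ℂ :=
  weight m ⟨slProj r (Matrix.single p p 1), slProj_diag_mem_cartan p⟩

theorem diagWeight_sub (i : Fin r) :
    diagWeight m i.castSucc - diagWeight m i.succ = m i := by
  rw [diagWeight, diagWeight, ← map_sub, ← weight_coroot m i]
  congr 1
  apply Subtype.ext
  change slProj r _ - slProj r _ = coroot r i
  rw [← map_sub, ← slProj_val (coroot r i)]
  rfl

theorem isHighestWeight_weylGen : IsHighestWeight (curUnit r) (diagWeight m) (weylGen m) where
  raising p q a h := by
    rw [curUnit, slProj_single h.ne]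
    exact (Relator.raising _ _ (Submodule.subset_span ⟨p, q, h, rfl⟩)).smul_weylGen
  cartan_pos p a := by
    rw [curUnit, pow_succ']
    exact (Relator.cartanPos _ ⟨_, slProj_diag_mem_cartan p⟩).smul_weylGen
  cartan_zero p := by
    have h := (Relator.cartanZero (m := m) ⟨_, slProj_diag_mem_cartan p⟩).smul_weylGen
    rw [sub_smul, sub_eq_zero, algebraMap_smul] at h
    rw [curUnit, pow_zero]
    exact h

theorem rank_weylModule_le :
    Module.rank ℂ (WeylModule m) ≤ (∏ i : Fin r, (r + 1).choose ((i : ℕ) + 1) ^ m i : ℕ) := by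
  have h := rank_span_singleton_le r (UCurrent r) (WeylModule m) (curUnit r) (isCurrentGL_curUnit r)
    (adjoin_curUnit r) (exists_lowering_pow_smul_eq_zero m) (diagWeight m) m (diagWeight_sub m)
    (weylGen m) (isHighestWeight_weylGen m)
  rw [span_weylGen] at h
  rwa [← rank_top]

/-! ### Products of minors as a model for tensor products of exterior powers. -/

section Minors

variable {J : Type*} {k : J → ℕ} {n : ℕ} {K : Type*} [CommRing K]

theorem derivation_prod {R S ι : Type*} [CommRing R] [CommRing S] [Algebra R S]
    (D : Derivation R S S) (s : Finset ι) (f : ι → S) [DecidableEq ι] :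
    D (∏ i ∈ s, f i) = ∑ i ∈ s, D (f i) * ∏ j ∈ s.erase i, f j := by
  induction s using Finset.induction_on with
  | empty => simp
  | insert a s ha ih =>
    rw [Finset.prod_insert ha, Derivation.leibniz, ih, Finset.sum_insert ha, Finset.erase_insert ha,
      smul_eq_mul, smul_eq_mul, add_comm, mul_comm (∏ i ∈ s, f i), Finset.mul_sum]
    congr 1
    refine Finset.sum_congr rfl fun i hi => ?_
    have hia : a ≠ i := fun h => ha (h ▸ hi)
    rw [Finset.erase_insert_of_ne hia, Finset.prod_insert (by simp [ha])]
    ring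

variable (k n) in
/-- The variables: for each `j : J` the entries of a matrix of size `k j × n`. -/
abbrev Entry : Type _ := Σ j : J, Fin (k j) × Fin n

/-- The derivation of the polynomial ring given by right multiplication of the `j`-th matrix of
variables by `F j`. -/
def der (F : J → Matrix (Fin n) (Fin n) K) :
    Derivation K (MvPolynomial (Entry k n) K) (MvPolynomial (Entry k n) K) :=
  MvPolynomial.mkDerivation K fun x =>
    ∑ p, MvPolynomial.C (F x.1 p x.2.2) * MvPolynomial.X ⟨x.1, x.2.1, p⟩

theorem der_X (F : J → Matrix (Fin n) (Fin n) K) (x : Entry k n) :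
    der F (MvPolynomial.X x) =
      ∑ p, MvPolynomial.C (F x.1 p x.2.2) * MvPolynomial.X (⟨x.1, x.2.1, p⟩ : Entry k n) :=
  MvPolynomial.mkDerivation_X _ _ _

theorem der_add (F G : J → Matrix (Fin n) (Fin n) K) : der (k := k) (F + G) = der F + der G := by
  refine MvPolynomial.derivation_ext fun x => ?_
  simp [der_X, add_mul, Finset.sum_add_distrib]

theorem der_smul (c : K) (F : J → Matrix (Fin n) (Fin n) K) :
    der (k := k) (c • F) = c • der F := by
  refine MvPolynomial.derivation_ext fun x => ?_
  simp [der_X, mul_assoc, Finset.smul_sum, MvPolynomial.smul_eq_C_mul]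

theorem der_zero : der (k := k) (0 : J → Matrix (Fin n) (Fin n) K) = 0 := by
  refine MvPolynomial.derivation_ext fun x => ?_
  simp [der_X]

theorem der_commutator (F G : J → Matrix (Fin n) (Fin n) K) :
    der (k := k) (F * G - G * F) = ⁅der (k := k) F, der (k := k) G⁆ := by
  refine MvPolynomial.derivation_ext fun x => ?_
  have h : ∀ F G : J → Matrix (Fin n) (Fin n) K, der (k := k) F (der G (MvPolynomial.X x)) =
      ∑ p, MvPolynomial.C ((F * G) x.1 p x.2.2) *
        MvPolynomial.X (⟨x.1, x.2.1, p⟩ : Entry k n) := by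
    intro F G
    rw [der_X, map_sum]
    simp only [Derivation.leibniz, MvPolynomial.derivation_C, mul_zero, add_zero, der_X,
      smul_eq_mul, Finset.mul_sum, Pi.mul_apply, Matrix.mul_apply, map_sum, Finset.sum_mul, map_mul]
    rw [Finset.sum_comm]
    refine Finset.sum_congr rfl fun p _ => Finset.sum_congr rfl fun q _ => by ring
  rw [Derivation.commutator_apply, h, h, der_X, ← Finset.sum_sub_distrib]
  refine Finset.sum_congr rfl fun p _ => ?_
  rw [← sub_mul, ← map_sub]
  rfl

variable (K) in
/-- The minor of the `j`-th matrix of variables formed by the columns `c`. -/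
def minor (j : J) (c : Fin (k j) → Fin n) : MvPolynomial (Entry k n) K :=
  Matrix.det (Matrix.of fun a b => MvPolynomial.X (⟨j, a, c b⟩ : Entry k n))

theorem minor_eq_zero (j : J) (c : Fin (k j) → Fin n) {a b : Fin (k j)} (hab : a ≠ b)
    (h : c a = c b) : minor K j c = 0 :=
  Matrix.det_zero_of_column_eq hab fun i => by simp [h]

theorem der_minor (F : J → Matrix (Fin n) (Fin n) K) (j : J) (c : Fin (k j) → Fin n) :
    der F (minor K j c) =
      ∑ b, ∑ p, MvPolynomial.C (F j p (c b)) * minor K j (Function.update c b p) := by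
  simp only [minor, Matrix.det_apply, map_sum, Finset.mul_sum]
  have h : ∀ σ : Equiv.Perm (Fin (k j)), der F (Equiv.Perm.sign σ • ∏ i, Matrix.of (fun a b =>
      MvPolynomial.X (R := K) (⟨j, a, c b⟩ : Entry k n)) (σ i) i) =
      ∑ b, ∑ p, MvPolynomial.C (F j p (c b)) * Equiv.Perm.sign σ • ∏ i, Matrix.of (fun a b' =>
        MvPolynomial.X (R := K) (⟨j, a, Function.update c b p b'⟩ : Entry k n)) (σ i) i := by
    intro σ
    rw [Units.smul_def, map_zsmul, derivation_prod, Finset.smul_sum]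
    refine Finset.sum_congr rfl fun b _ => ?_
    rw [Matrix.of_apply, der_X, Finset.sum_mul, Finset.smul_sum]
    refine Finset.sum_congr rfl fun p _ => ?_
    rw [mul_smul_comm, ← Finset.mul_prod_erase _ _ (Finset.mem_univ b), mul_assoc]
    simp only [Matrix.of_apply, Function.update_self]
    congr 3
    refine Finset.prod_congr rfl fun i hi => ?_
    rw [Function.update_of_ne (Finset.ne_of_mem_erase hi)]
  rw [Finset.sum_congr rfl fun σ _ => h σ, Finset.sum_comm]
  refine Finset.sum_congr rfl fun b _ => ?_
  rw [Finset.sum_comm]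

variable [Fintype J] [DecidableEq J]

variable (K) in
/-- The product of the minors formed by the columns `T j` of the `j`-th matrix. -/
def minorProd (T : ∀ j, Fin (k j) → Fin n) : MvPolynomial (Entry k n) K := ∏ j, minor K j (T j)

theorem minorProd_update (T : ∀ j, Fin (k j) → Fin n) (j : J) (c : Fin (k j) → Fin n) :
    minorProd K (Function.update T j c) =
      minor K j c * ∏ l ∈ Finset.univ.erase j, minor K l (T l) := by
  rw [minorProd, ← Finset.mul_prod_erase _ _ (Finset.mem_univ j), Function.update_self]
  congr 1
  refine Finset.prod_congr rfl fun i hi => ?_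
  rw [Function.update_of_ne (Finset.ne_of_mem_erase hi)]

theorem der_minorProd (F : J → Matrix (Fin n) (Fin n) K) (T : ∀ j, Fin (k j) → Fin n) :
    der F (minorProd K T) = ∑ j, ∑ b, ∑ p, MvPolynomial.C (F j p (T j b)) *
      minorProd K (Function.update T j (Function.update (T j) b p)) := by
  rw [minorProd, derivation_prod]
  refine Finset.sum_congr rfl fun j _ => ?_
  rw [der_minor, Finset.sum_mul]
  refine Finset.sum_congr rfl fun b _ => ?_
  rw [Finset.sum_mul]
  refine Finset.sum_congr rfl fun p _ => ?_
  rw [minorProd_update, mul_assoc]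

theorem minorProd_update_eq_zero (T : ∀ j, Fin (k j) → Fin n) (j : J) (c : Fin (k j) → Fin n)
    {a b : Fin (k j)} (hab : a ≠ b) (h : c a = c b) :
    minorProd K (Function.update T j c) = 0 := by
  rw [minorProd_update, minor_eq_zero j c hab h, zero_mul]

/-- By Leibniz, nilpotency orders on the factors add: if `p + q = t`, each of the two terms of `D (a
* b)` lowers `p` or `q` by one. -/
theorem der_pow_prod_eq_zero {R S ι : Type*} [CommRing R] [CommRing S] [Algebra R S]
    (D : Derivation R S S) (s : Finset ι) (f : ι → S) (N : ι → ℕ)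
    (h : ∀ i ∈ s, (D : S →ₗ[R] S) ^ (N i + 1) • f i = 0) :
    (D : S →ₗ[R] S) ^ (∑ i ∈ s, N i + 1) • ∏ i ∈ s, f i = 0 := by
  classical
  have key : ∀ t p q : ℕ, p + q = t → ∀ a b : S, (D : S →ₗ[R] S) ^ (p + 1) • a = 0 →
      (D : S →ₗ[R] S) ^ (q + 1) • b = 0 → (D : S →ₗ[R] S) ^ (t + 1) • (a * b) = 0 := by
    intro t
    induction t with
    | zero =>
      intro p q hpq a b ha hb
      obtain ⟨rfl, rfl⟩ : p = 0 ∧ q = 0 := by omega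
      have ha' : D a = 0 := by simpa using ha
      have hb' : D b = 0 := by simpa using hb
      simp [ha', hb']
    | succ t ih =>
      intro p q hpq a b ha hb
      rw [pow_succ, mul_smul]
      have h1 : (D : S →ₗ[R] S) • (a * b) = a * D b + D a * b := by
        simp [mul_comm]
      rw [h1, smul_add]
      have hp : (D : S →ₗ[R] S) ^ (t + 1) • (a * D b) = 0 := by
        cases q with
        | zero =>
          have hb' : D b = 0 := by simpa using hb
          simp [hb']
        | succ q =>
          refine ih p q (by omega) a (D b) ha ?_
          rw [pow_succ, mul_smul] at hb
          exact hb
      have hq : (D : S →ₗ[R] S) ^ (t + 1) • (D a * b) = 0 := by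
        cases p with
        | zero =>
          have ha' : D a = 0 := by simpa using ha
          simp [ha']
        | succ p =>
          refine ih p q (by omega) (D a) b ?_ hb
          rw [pow_succ, mul_smul] at ha
          exact ha
      rw [hp, hq, add_zero]
  induction s using Finset.induction_on with
  | empty => simp
  | insert a s ha ih =>
    rw [Finset.prod_insert ha, Finset.sum_insert ha]
    exact key _ _ _ rfl _ _ (h a (Finset.mem_insert_self a s))
      (ih fun i hi => h i (Finset.mem_insert_of_mem hi))

/-- Evaluation at the matrices whose rows are the unit vectors given by `T`. -/
def evalAt (T : ∀ j, Fin (k j) → Fin n) : MvPolynomial (Entry k n) K →ₐ[K] K :=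
  MvPolynomial.aeval fun x => if T x.1 x.2.1 = x.2.2 then 1 else 0

omit [Fintype J] [DecidableEq J] in
theorem evalAt_minor (T : ∀ j, Fin (k j) → Fin n) (j : J) (c : Fin (k j) → Fin n) :
    evalAt T (minor K j c) = Matrix.det (Matrix.of fun a b => if T j a = c b then (1 : K) else 0) := by
  rw [minor, AlgHom.map_det]
  congr 1
  ext a b
  simp [evalAt]

/-- The families of strictly increasing column choices, given by their sets of values. -/
abbrev ColumnSets (k : J → ℕ) (n : ℕ) : Type _ := ∀ j, {s : Finset (Fin n) // s.card = k j}

/-- The columns in increasing order. -/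
def columns (s : ColumnSets k n) (j : J) : Fin (k j) → Fin n := (s j).1.orderEmbOfFin (s j).2

omit [Fintype J] [DecidableEq J] in
theorem strictMono_columns (s : ColumnSets k n) (j : J) : StrictMono (columns s j) :=
  OrderEmbedding.strictMono _

omit [DecidableEq J] in
-- The evaluations are dual to the products of minors: distinct column sets of equal size leave some
-- minor with a zero column. They give both linear independence and a map to a free module of finite
-- rank.
theorem evalAt_minorProd (s t : ColumnSets k n) :
    evalAt (columns s) (minorProd K (columns t)) = if s = t then 1 else 0 := by
  rw [minorProd, map_prod]
  split_ifs with h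
  · subst h
    refine Finset.prod_eq_one fun j _ => ?_
    rw [evalAt_minor, ← Matrix.det_one (n := Fin (k j)) (R := K)]
    congr 1
    ext a b
    simp [Matrix.one_apply, (strictMono_columns s j).injective.eq_iff]
  · obtain ⟨j, hj⟩ : ∃ j, s j ≠ t j := by
      by_contra! hst
      exact h (funext hst)
    obtain ⟨x, hx, hxs⟩ : ∃ x ∈ (t j).1, x ∉ (s j).1 := by
      by_contra! hst
      refine hj (Subtype.ext (Finset.eq_of_subset_of_card_le hst ?_).symm)
      rw [(s j).2, (t j).2]
    obtain ⟨b, hb⟩ : ∃ b, columns t j b = x := by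
      have : x ∈ Set.range ((t j).1.orderEmbOfFin (t j).2) := by
        rw [Finset.range_orderEmbOfFin]
        exact hx
      exact this
    refine Finset.prod_eq_zero (Finset.mem_univ j) ?_
    rw [evalAt_minor]
    refine Matrix.det_eq_zero_of_column_eq_zero b fun a => ?_
    rw [Matrix.of_apply, if_neg]
    intro hab
    rw [hb] at hab
    exact hxs (hab ▸ Finset.orderEmbOfFin_mem _ _ a)

end Minors

/-! ### The action over `ℂ[ε]`, the lattice and the counting argument. -/

section Deformation

variable {r : ℕ} {J : Type*} (k : J → ℕ) (z : J → ℂ)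

/-- The evaluations of the current algebra at the points `ε z j`, with values in the matrices over
`ℂ[ε]`. -/
def evalPoints (r : ℕ) :
    Current r →ₗ[ℂ] J → Matrix (Fin (r + 1)) (Fin (r + 1)) ℂ[X] :=
  TensorProduct.lift (LinearMap.mk₂ ℂ
    (fun (f : ℂ[X]) (x : g r) (j : J) => f.comp (Polynomial.C (z j) * Polynomial.X) •
      (x : Matrix (Fin (r + 1)) (Fin (r + 1)) ℂ).map Polynomial.C)
    (fun f f' x => by ext1 j; simp [add_smul])
    (fun c f x => by ext1 j; simp)
    (fun f x y => by
      ext1 j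
      have : ((x + y : g r) : Matrix (Fin (r + 1)) (Fin (r + 1)) ℂ).map Polynomial.C =
        (x : Matrix (Fin (r + 1)) (Fin (r + 1)) ℂ).map Polynomial.C +
          (y : Matrix (Fin (r + 1)) (Fin (r + 1)) ℂ).map Polynomial.C := by ext; simp
      rw [this, smul_add]
      rfl)
    (fun c f x => by
      ext1 j
      have : ((c • x : g r) : Matrix (Fin (r + 1)) (Fin (r + 1)) ℂ).map Polynomial.C =
        c • (x : Matrix (Fin (r + 1)) (Fin (r + 1)) ℂ).map Polynomial.C := by
          ext; simp [Polynomial.smul_eq_C_mul]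
      rw [this, smul_comm]
      rfl))

theorem evalPoints_tmul (f : ℂ[X]) (x : g r) (j : J) :
    evalPoints z r (f ⊗ₜ x) j = f.comp (Polynomial.C (z j) * Polynomial.X) •
      (x : Matrix (Fin (r + 1)) (Fin (r + 1)) ℂ).map Polynomial.C := rfl

theorem evalPoints_lie (a b : Current r) :
    evalPoints z r ⁅a, b⁆ = evalPoints z r a * evalPoints z r b -
      evalPoints z r b * evalPoints z r a := by
  induction a using TensorProduct.induction_on with
  | zero =>
    have h : ⁅(0 : Current r), b⁆ = 0 := zero_lie b
    rw [h]
    simp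
  | add a a' ha ha' =>
    have h : ⁅a + a', b⁆ = ⁅a, b⁆ + ⁅a', b⁆ := add_lie a a' b
    rw [h, map_add, map_add, ha, ha']
    noncomm_ring
  | tmul f x =>
    induction b using TensorProduct.induction_on with
    | zero =>
      have h : ⁅f ⊗ₜ[ℂ] x, (0 : Current r)⁆ = 0 := lie_zero (f ⊗ₜ[ℂ] x : Current r)
      rw [h]
      simp
    | add b b' hb hb' =>
      have h : ⁅f ⊗ₜ[ℂ] x, b + b'⁆ = ⁅f ⊗ₜ[ℂ] x, b⁆ + ⁅f ⊗ₜ[ℂ] x, b'⁆ :=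
        lie_add (f ⊗ₜ[ℂ] x : Current r) b b'
      rw [h, map_add, map_add, hb, hb']
      noncomm_ring
    | tmul f' y =>
      ext1 j
      rw [LieAlgebra.ExtendScalars.bracket_tmul, evalPoints_tmul, Pi.sub_apply, Pi.mul_apply,
        Pi.mul_apply, evalPoints_tmul, evalPoints_tmul, Polynomial.mul_comp]
      have : ((⁅x, y⁆ : g r) : Matrix (Fin (r + 1)) (Fin (r + 1)) ℂ).map Polynomial.C =
          (x : Matrix (Fin (r + 1)) (Fin (r + 1)) ℂ).map Polynomial.C *
            (y : Matrix (Fin (r + 1)) (Fin (r + 1)) ℂ).map Polynomial.C -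
          (y : Matrix (Fin (r + 1)) (Fin (r + 1)) ℂ).map Polynomial.C *
            (x : Matrix (Fin (r + 1)) (Fin (r + 1)) ℂ).map Polynomial.C := by
        rw [LieAlgebra.SpecialLinear.sl_bracket, Matrix.map_sub Polynomial.C (by simp),
          Matrix.map_mul, Matrix.map_mul]
      rw [this, smul_sub, smul_mul_smul_comm, smul_mul_smul_comm, mul_comm (f'.comp _)]

/-- The polynomial ring on which the current algebra acts. -/
abbrev DefRing (r : ℕ) (k : J → ℕ) : Type _ := MvPolynomial (Entry k (r + 1)) ℂ[X]

/-- The action of the current algebra by derivations. -/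
def currentAction (r : ℕ) : Current r →ₗ⁅ℂ⁆ Module.End ℂ[X] (DefRing r k) where
  toFun a := (der (k := k) (evalPoints z r a) : DefRing r k →ₗ[ℂ[X]] DefRing r k)
  map_add' a b := by
    rw [map_add, der_add]
    rfl
  map_smul' c a := by
    have : c • evalPoints z r a = Polynomial.C c • evalPoints z r a := by
      ext
      simp [Polynomial.smul_eq_C_mul]
    rw [map_smul, this, der_smul]
    refine LinearMap.ext fun q => ?_
    exact algebraMap_smul ℂ[X] c (der (k := k) (evalPoints z r a) q)
  map_lie' := by
    intro a b
    have h := evalPoints_lie z a b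
    rw [← Derivation.commutator_coe_linear_map, ← der_commutator, ← h]

/-- The action of the enveloping algebra. -/
def envAction (r : ℕ) : UCurrent r →ₐ[ℂ] Module.End ℂ[X] (DefRing r k) :=
  UniversalEnvelopingAlgebra.lift ℂ (currentAction k z r)

theorem envAction_cur (f : ℂ[X]) (x : g r) (q : DefRing r k) :
    envAction k z r (cur f x) q = der (evalPoints z r (f ⊗ₜ x)) q := by
  rw [envAction, cur, UniversalEnvelopingAlgebra.lift_ι_apply]
  rfl

/-- The lattice generated by the action on `v`. -/
def lattice (v : DefRing r k) : Submodule ℂ[X] (DefRing r k) :=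
  Submodule.span ℂ[X] (Set.range fun u => envAction k z r u v)

variable {k z}

theorem envAction_mem_lattice (v : DefRing r k) (u : UCurrent r) {q : DefRing r k}
    (hq : q ∈ lattice k z v) : envAction k z r u q ∈ lattice k z v := by
  induction hq using Submodule.span_induction with
  | mem q hq =>
    obtain ⟨u', rfl⟩ := hq
    refine Submodule.subset_span ⟨u * u', ?_⟩
    simp
  | zero => rw [map_zero]; exact zero_mem _
  | add p q _ _ hp hq => rw [map_add]; exact add_mem hp hq
  | smul c q _ hq => rw [map_smul]; exact Submodule.smul_mem _ _ hq

theorem self_mem_lattice (v : DefRing r k) : v ∈ lattice k z v :=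
  Submodule.subset_span ⟨1, by simp⟩

/-- The lattice is stable under the enveloping algebra, so the elements sending `v` into `ε` times
the lattice form a left ideal. -/
theorem relations_act {m : Fin r → ℕ} (v : DefRing r k)
    (h : ∀ u, Relator m u → ∃ q ∈ lattice k z v,
      envAction k z r u v = (Polynomial.X : ℂ[X]) • q) {u : UCurrent r} (hu : u ∈ relations m) :
    ∃ q ∈ lattice k z v, envAction k z r u v = (Polynomial.X : ℂ[X]) • q := by
  induction hu using Submodule.span_induction with
  | mem u hu => exact h u hu
  | zero => exact ⟨0, zero_mem _, by simp⟩
  | add u u' _ _ hu hu' =>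
    obtain ⟨q, hq, e⟩ := hu
    obtain ⟨q', hq', e'⟩ := hu'
    exact ⟨q + q', add_mem hq hq', by rw [map_add, LinearMap.add_apply, e, e', smul_add]⟩
  | smul a u _ hu =>
    obtain ⟨q, hq, e⟩ := hu
    exact ⟨envAction k z r a q, envAction_mem_lattice v a hq, by
      rw [smul_eq_mul, map_mul, Module.End.mul_apply, e, map_smul]⟩

/-- The counting argument: the lattice has rank at most the dimension of the Weyl module. -/
theorem card_le_finrank [Fintype J] [DecidableEq J] {m : Fin r → ℕ} [FiniteDimensional ℂ (WeylModule m)] (v : DefRing r k)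
    (h : ∀ u, Relator m u → ∃ q ∈ lattice k z v,
      envAction k z r u v = (Polynomial.X : ℂ[X]) • q)
    (hmem : ∀ T : ColumnSets k (r + 1), ∃ N : ℕ,
      (Polynomial.X ^ N : ℂ[X]) • minorProd ℂ[X] (columns T) ∈ lattice k z v) :
    Fintype.card (ColumnSets k (r + 1)) ≤ Module.finrank ℂ (WeylModule m) := by
  classical
  let ev : DefRing r k →ₗ[ℂ[X]] (ColumnSets k (r + 1) → ℂ[X]) :=
    LinearMap.pi fun T => (evalAt (columns T)).toLinearMap
  let b := Module.finBasis ℂ (WeylModule m)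
  choose u hu using fun i => (relations m).mkQ_surjective (b i)
  let Q : Submodule ℂ[X] (ColumnSets k (r + 1) → ℂ[X]) :=
    Submodule.span ℂ[X] (Set.range fun i => ev (envAction k z r (u i) v))
  let L' := (lattice k z v).map ev
  -- Modulo the relations, any element of the enveloping algebra is a combination of the lifts `u i`
  -- of a basis of `W(λ)`. Working with the image `L'` under `ev` makes finite generation automatic
  -- over the Noetherian ring `ℂ[ε]`.
  have hL : L' ≤ Q ⊔ (Ideal.span {(Polynomial.X : ℂ[X])}) • L' := by
    rw [Submodule.map_le_iff_le_comap, lattice, Submodule.span_le]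
    rintro _ ⟨x, rfl⟩
    have hx : x - ∑ i, b.repr ((relations m).mkQ x) i • u i ∈ relations m := by
      rw [← Submodule.Quotient.mk_eq_zero, ← Submodule.mkQ_apply, map_sub, map_sum, sub_eq_zero]
      conv_lhs => rw [← b.sum_repr ((relations m).mkQ x)]
      refine Finset.sum_congr rfl fun i _ => ?_
      rw [← hu]
      exact (LinearMap.map_smul_of_tower (relations m).mkQ _ _).symm
    obtain ⟨q, hq, e⟩ := relations_act v h hx
    rw [map_sub, LinearMap.sub_apply, sub_eq_iff_eq_add'] at e
    change ev (envAction k z r x v) ∈ Q ⊔ (Ideal.span {(Polynomial.X : ℂ[X])}) • L'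
    rw [e, map_add, map_smul]
    refine add_mem (Submodule.mem_sup_left ?_) (Submodule.mem_sup_right
      (Submodule.smul_mem_smul (Ideal.mem_span_singleton_self _) ⟨q, hq, rfl⟩))
    rw [map_sum, LinearMap.sum_apply, map_sum]
    refine sum_mem fun i _ => ?_
    rw [map_smul, LinearMap.smul_apply, LinearMap.map_smul_of_tower]
    exact Submodule.smul_of_tower_mem _ _ (Submodule.subset_span ⟨i, rfl⟩)
  -- Nakayama's lemma for `L' / (L' ∩ Q)`: some `q` congruent to `1` modulo `ε`, hence nonzero,
  -- carries `L'` into `Q`.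
  obtain ⟨q, hq1, hq⟩ := Submodule.exists_sub_one_mem_and_smul_eq_zero_of_fg_of_le_smul
    (Ideal.span {(Polynomial.X : ℂ[X])}) (L'.map Q.mkQ) (IsNoetherian.noetherian _) (by
      rw [← Submodule.map_smul'']
      refine (Submodule.map_mono hL).trans ?_
      rw [Submodule.map_sup, Submodule.mkQ_map_self, bot_sup_eq])
  have hq0 : q ≠ 0 := by
    rintro rfl
    rw [Ideal.mem_span_singleton, zero_sub, dvd_neg] at hq1
    exact Polynomial.not_isUnit_X (isUnit_of_dvd_one hq1)
  have hqL : ∀ y ∈ L', q • y ∈ Q := by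
    intro y hy
    have := hq _ (Submodule.mem_map_of_mem (f := Q.mkQ) hy)
    rwa [← map_smul, Submodule.mkQ_apply, Submodule.Quotient.mk_eq_zero] at this
  choose N hN using hmem
  -- Under `ev` these become nonzero multiples of the standard basis vectors, so the rank of `Q` is
  -- at least their number.
  let w : ColumnSets k (r + 1) → Q := fun T =>
    ⟨q • ev ((Polynomial.X ^ N T : ℂ[X]) • minorProd ℂ[X] (columns T)),
      hqL _ ⟨_, hN T, rfl⟩⟩
  have hw : LinearIndependent ℂ[X] w := by
    rw [Fintype.linearIndependent_iff]
    intro c hc T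
    have h1 := congrFun (congrArg Subtype.val hc) T
    simp only [w, ev, AddSubmonoidClass.coe_finsetSum, Submodule.coe_smul, map_smul,
      Finset.sum_apply, Pi.smul_apply, LinearMap.pi_apply, AlgHom.toLinearMap_apply,
      evalAt_minorProd, ZeroMemClass.coe_zero, Pi.zero_apply, smul_eq_mul, mul_ite, mul_one,
      mul_zero, Finset.sum_ite_eq, Finset.mem_univ, if_true] at h1
    have h2 : (Polynomial.X ^ N T : ℂ[X]) ≠ 0 := pow_ne_zero _ Polynomial.X_ne_zero
    simpa [hq0, h2] using h1
  calc Fintype.card (ColumnSets k (r + 1)) ≤ Module.finrank ℂ[X] Q :=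
        hw.fintype_card_le_finrank
    _ ≤ Fintype.card (Fin (Module.finrank ℂ (WeylModule m))) := finrank_range_le_card _
    _ = _ := Fintype.card_fin _

end Deformation

/-! ### Highest weight vectors: minors on the leftmost columns. -/

section StandardColumns

variable {J : Type*} {k : J → ℕ} {n : ℕ} {K : Type*} [CommRing K]

/-- The leftmost columns. -/
def stdColumns (hk : ∀ j, k j ≤ n) (j : J) (b : Fin (k j)) : Fin n := Fin.castLE (hk j) b

/-- An entry above the diagonal replaces a column by one further left, which already occurs in the
minor, so only the diagonal entries contribute. -/
theorem der_minorProd_stdColumns [Fintype J] [DecidableEq J] (hk : ∀ j, k j ≤ n)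
    (F : J → Matrix (Fin n) (Fin n) K) (hF : ∀ j p q, q < p → F j p q = 0) :
    der F (minorProd K (stdColumns hk)) =
      (∑ j, ∑ b, F j (stdColumns hk j b) (stdColumns hk j b)) • minorProd K (stdColumns hk) := by
  rw [der_minorProd, Finset.sum_smul]
  refine Finset.sum_congr rfl fun j _ => ?_
  rw [Finset.sum_smul]
  refine Finset.sum_congr rfl fun b _ => ?_
  rw [Finset.sum_eq_single (stdColumns hk j b)]
  · rw [Function.update_eq_self, Function.update_eq_self, MvPolynomial.smul_eq_C_mul]
  · intro p _ hp
    rcases lt_or_gt_of_ne hp with h | h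
    · have hpb : (p : ℕ) < b := h
      let a : Fin (k j) := ⟨p, hpb.trans b.2⟩
      have hab : a ≠ b := fun e => hpb.ne (congrArg Fin.val e)
      rw [minorProd_update_eq_zero _ _ _ hab, mul_zero]
      rw [Function.update_self, Function.update_of_ne hab]
      rfl
    · rw [hF j p _ h, map_zero, zero_mul]
  · exact fun h => absurd (Finset.mem_univ _) h

theorem der_single_minor (p q : Fin n) (j : J) (c : Fin (k j) → Fin n) :
    der (fun _ : J => Matrix.single p q (1 : K)) (minor K j c) =
      ∑ b with c b = q, minor K j (Function.update c b p) := by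
  rw [der_minor, Finset.sum_filter]
  refine Finset.sum_congr rfl fun b _ => ?_
  rw [Finset.sum_eq_single p]
  · by_cases h : c b = q
    · simp [h]
    · simp [h, Ne.symm h]
  · intro p' _ hp
    simp [Ne.symm hp]
  · exact fun h => absurd (Finset.mem_univ _) h

theorem der_single_minor_eq_zero (p q : Fin n) (j : J) (c : Fin (k j) → Fin n)
    (h : ∀ b, c b = q → ∃ a, a ≠ b ∧ c a = p) :
    der (fun _ : J => Matrix.single p q (1 : K)) (minor K j c) = 0 := by
  rw [der_single_minor]
  refine Finset.sum_eq_zero fun b hb => ?_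
  obtain ⟨a, hab, ha⟩ := h b (Finset.mem_filter.1 hb).2
  exact minor_eq_zero j _ hab (by rw [Function.update_self, Function.update_of_ne hab, ha])

theorem der_single_der_single_minor_eq_zero {p q : Fin n} (hpq : p ≠ q) (j : J)
    (c : Fin (k j) → Fin n) (hc : Function.Injective c) :
    der (fun _ : J => Matrix.single p q (1 : K))
      (der (fun _ : J => Matrix.single p q (1 : K)) (minor K j c)) = 0 := by
  rw [der_single_minor, map_sum]
  refine Finset.sum_eq_zero fun b hb => der_single_minor_eq_zero p q j _ fun a ha => ?_
  by_cases hab : a = b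
  · subst hab
    rw [Function.update_self] at ha
    exact absurd ha hpq
  · rw [Function.update_of_ne hab] at ha
    exact absurd (hc (ha.trans (Finset.mem_filter.1 hb).2.symm)) hab

theorem der_piSingle_minorProd [Fintype J] [DecidableEq J] (p q : Fin n) (j : J)
    (T : ∀ j, Fin (k j) → Fin n) (b : Fin (k j)) (hT : Function.Injective (T j))
    (hb : T j b = q) :
    der (Pi.single j (Matrix.single p q (1 : K))) (minorProd K T) =
      minorProd K (Function.update T j (Function.update (T j) b p)) := by
  rw [der_minorProd, Finset.sum_eq_single j, Finset.sum_eq_single b, Finset.sum_eq_single p]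
  · simp [hb]
  · intro p' _ hp
    simp [Ne.symm hp]
  · exact fun h => absurd (Finset.mem_univ _) h
  · intro b' _ hbb
    have : q ≠ T j b' := fun e => hbb (hT (e.symm.trans hb.symm))
    simp [this]
  · exact fun h => absurd (Finset.mem_univ _) h
  · intro l _ hl
    simp [Pi.single_eq_of_ne hl]
  · exact fun h => absurd (Finset.mem_univ _) h

theorem le_apply_of_strictMono {a : ℕ} {c : Fin a → Fin n} (hc : StrictMono c) (b : Fin a) :
    (b : ℕ) ≤ c b := by
  obtain ⟨b, hb⟩ := b
  induction b with
  | zero => exact Nat.zero_le _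
  | succ b ih =>
    have h1 := ih (by omega)
    have h2 : c ⟨b, by omega⟩ < c ⟨b + 1, hb⟩ := hc (Fin.mk_lt_mk.2 (Nat.lt_succ_self b))
    exact Nat.succ_le_of_lt (lt_of_le_of_lt h1 h2)

end StandardColumns

/-! ### After inverting `ε`, the lattice contains every product of minors. -/

section Generation

variable {r : ℕ} {J : Type*} {k : J → ℕ} {z : J → ℂ}

theorem der_evalPoints_mem_lattice (v : DefRing r k) (f : ℂ[X]) (x : g r) {q : DefRing r k}
    (hq : q ∈ lattice k z v) : der (evalPoints z r (f ⊗ₜ x)) q ∈ lattice k z v := by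
  rw [← envAction_cur]
  exact envAction_mem_lattice v _ hq

variable [Fintype J] [DecidableEq J]

/-- If `p` is the Lagrange polynomial equal to `1` at `z j` and to `0` at the other points, then `ε
^ N p(t / ε)` with `N` the degree of `p` is polynomial in `t` and `ε`; at `t = ε z l` it is `ε ^ N`
or `0`. Thus a Lie algebra element acting on the factor `j` alone is available up to a power of `ε`.
-/
theorem exists_X_pow_smul_piSingle (hz : Function.Injective z) (j : J) :
    ∃ N : ℕ, ∀ x : g r, (Polynomial.X ^ N : ℂ[X]) •
        (Pi.single j ((x : Matrix (Fin (r + 1)) (Fin (r + 1)) ℂ).map Polynomial.C) :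
          J → Matrix (Fin (r + 1)) (Fin (r + 1)) ℂ[X]) =
      ∑ a ∈ Finset.range (N + 1),
        (Polynomial.C ((Lagrange.basis Finset.univ z j).coeff a) * Polynomial.X ^ (N - a)) •
          evalPoints z r ((Polynomial.X ^ a) ⊗ₜ x) := by
  refine ⟨(Lagrange.basis Finset.univ z j).natDegree, fun x => ?_⟩
  set p := Lagrange.basis Finset.univ z j with hp
  ext1 l
  have h1 : ∑ a ∈ Finset.range (p.natDegree + 1),
      (Polynomial.C (p.coeff a) * Polynomial.X ^ (p.natDegree - a)) *
        (Polynomial.C (z l) * Polynomial.X) ^ a =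
      Polynomial.C (p.eval (z l)) * Polynomial.X ^ p.natDegree := by
    rw [Polynomial.eval_eq_sum_range, map_sum, Finset.sum_mul]
    refine Finset.sum_congr rfl fun a ha => ?_
    have ha' : a ≤ p.natDegree := Nat.lt_succ_iff.1 (Finset.mem_range.1 ha)
    rw [← pow_sub_mul_pow Polynomial.X ha', map_mul, map_pow]
    ring
  rw [Finset.sum_apply]
  simp only [Pi.smul_apply, evalPoints_tmul, Polynomial.pow_comp, Polynomial.X_comp, smul_smul]
  rw [← Finset.sum_smul, h1]
  by_cases hl : l = j
  · subst hl
    rw [hp, Lagrange.eval_basis_self hz.injOn (Finset.mem_univ _), Pi.single_eq_same, map_one,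
      one_mul]
  · rw [hp, Lagrange.eval_basis_of_ne (Ne.symm hl) (Finset.mem_univ _), Pi.single_eq_of_ne hl]
    simp

theorem exists_X_pow_smul_der_piSingle_mem (hz : Function.Injective z) (v : DefRing r k) (j : J)
    (x : g r) : ∃ N : ℕ, ∀ q ∈ lattice k z v, (Polynomial.X ^ N : ℂ[X]) •
      der (Pi.single j ((x : Matrix (Fin (r + 1)) (Fin (r + 1)) ℂ).map Polynomial.C)) q ∈
        lattice k z v := by
  obtain ⟨N, hN⟩ := exists_X_pow_smul_piSingle (r := r) hz j
  refine ⟨N, fun q hq => ?_⟩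
  have hsum : ∀ (s : Finset ℕ) (c : ℕ → ℂ[X]) (F : ℕ → J → Matrix _ _ ℂ[X]),
      (∀ a, der (F a) q ∈ lattice k z v) → der (∑ a ∈ s, c a • F a) q ∈ lattice k z v := by
    intro s c F hF
    induction s using Finset.induction_on with
    | empty => simp [der_zero]
    | insert a s ha ih =>
      rw [Finset.sum_insert ha, der_add, der_smul]
      exact add_mem (Submodule.smul_mem _ _ (hF a)) ih
  have := hsum (Finset.range (N + 1))
    (fun a => Polynomial.C ((Lagrange.basis Finset.univ z j).coeff a) * Polynomial.X ^ (N - a))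
    _ fun a =>
    der_evalPoints_mem_lattice v (Polynomial.X ^ a) x hq
  rw [← hN x, der_smul] at this
  exact this

theorem exists_X_pow_smul_minorProd_update (hz : Function.Injective z) (v : DefRing r k)
    (T : ∀ j, Fin (k j) → Fin (r + 1)) (j : J) (hT : Function.Injective (T j)) (b : Fin (k j))
    (p : Fin (r + 1))
    (h : ∃ N : ℕ, (Polynomial.X ^ N : ℂ[X]) • minorProd ℂ[X] T ∈ lattice k z v) :
    ∃ N : ℕ, (Polynomial.X ^ N : ℂ[X]) •
      minorProd ℂ[X] (Function.update T j (Function.update (T j) b p)) ∈ lattice k z v := by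
  by_cases hp : p = T j b
  · rwa [hp, Function.update_eq_self, Function.update_eq_self]
  · obtain ⟨N, hN⟩ := h
    obtain ⟨M, hM⟩ := exists_X_pow_smul_der_piSingle_mem hz v j (E r p (T j b) hp)
    refine ⟨M + N, ?_⟩
    have := hM _ hN
    have hE : ((E r p (T j b) hp : g r) : Matrix (Fin (r + 1)) (Fin (r + 1)) ℂ).map
        Polynomial.C = Matrix.single p (T j b) 1 := by
      simp [E]
    rw [hE, Derivation.map_smul, der_piSingle_minorProd p _ j T b hT rfl, smul_smul,
      ← pow_add] at this
    exact this

theorem exists_X_pow_smul_minorProd_update_strictMono (hz : Function.Injective z)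
    (v : DefRing r k) (T : ∀ j, Fin (k j) → Fin (r + 1)) (hk : ∀ j, k j ≤ r + 1) (j : J)
    (hT : T j = stdColumns hk j) (c : Fin (k j) → Fin (r + 1)) (hc : StrictMono c)
    (h : ∃ N : ℕ, (Polynomial.X ^ N : ℂ[X]) • minorProd ℂ[X] T ∈ lattice k z v) :
    ∃ N : ℕ, (Polynomial.X ^ N : ℂ[X]) •
      minorProd ℂ[X] (Function.update T j c) ∈ lattice k z v := by
  -- The columns are changed from the last one down to the first. Since `b ≤ c b` for increasing
  -- `c`, every intermediate choice is strictly increasing, hence injective.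
  let d : ℕ → Fin (k j) → Fin (r + 1) := fun t b => if t ≤ (b : ℕ) then c b else stdColumns hk j b
  have hd : ∀ t, Function.Injective (d t) := by
    refine fun t => StrictMono.injective fun b b' hb => ?_
    have h1 : (b : ℕ) < b' := hb
    have h2 := le_apply_of_strictMono hc b'
    simp only [d]
    split_ifs with h3 h4 h4
    · exact hc hb
    · omega
    · exact Fin.lt_def.2 (lt_of_lt_of_le h1 h2)
    · exact hb
  have key : ∀ s t, s + t = k j → ∃ N : ℕ, (Polynomial.X ^ N : ℂ[X]) •
      minorProd ℂ[X] (Function.update T j (d t)) ∈ lattice k z v := by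
    intro s
    induction s with
    | zero =>
      intro t ht
      have : d t = T j := by
        funext b
        have := b.2
        simp only [d, hT]
        rw [if_neg (by omega)]
      rwa [this, Function.update_eq_self]
    | succ s ih =>
      intro t ht
      have htk : t < k j := by omega
      have := exists_X_pow_smul_minorProd_update hz v (Function.update T j (d (t + 1))) j
        (by rw [Function.update_self]; exact hd _) ⟨t, htk⟩ (c ⟨t, htk⟩) (ih (t + 1) (by omega))
      rw [Function.update_idem, Function.update_self] at this
      convert this using 7
      funext b
      by_cases hb : b = ⟨t, htk⟩
      · subst hb
        simp [d]
      · have hbt : (b : ℕ) ≠ t := fun e => hb (Fin.ext e)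
        rw [Function.update_of_ne hb]
        simp only [d]
        have : t ≤ (b : ℕ) ↔ t + 1 ≤ (b : ℕ) := by omega
        simp only [this]
  have := key (k j) 0 (by omega)
  have hd0 : d 0 = c := by
    funext b
    simp [d]
  rwa [hd0] at this

theorem exists_X_pow_smul_minorProd_columns (hz : Function.Injective z) (hk : ∀ j, k j ≤ r + 1)
    (T : ColumnSets k (r + 1)) : ∃ N : ℕ, (Polynomial.X ^ N : ℂ[X]) •
      minorProd ℂ[X] (columns T) ∈ lattice k z (minorProd ℂ[X] (stdColumns hk)) := by
  have key : ∀ s : Finset J, ∃ N : ℕ, (Polynomial.X ^ N : ℂ[X]) •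
      minorProd ℂ[X] (fun j => if j ∈ s then columns T j else stdColumns hk j) ∈
        lattice k z (minorProd ℂ[X] (stdColumns hk)) := by
    intro s
    induction s using Finset.induction_on with
    | empty => exact ⟨0, by simpa using self_mem_lattice _⟩
    | insert a s ha ih =>
      have := exists_X_pow_smul_minorProd_update_strictMono hz _ _ hk a (by simp [ha])
        (columns T a) (strictMono_columns T a) ih
      convert this using 5
      funext j
      by_cases hj : j = a
      · subst hj
        simp
      · simp [hj]
  simpa using key Finset.univ

end Generation

/-! ### The fusion product of the fundamental representations and the conclusion. -/

section LowerBound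

variable {r : ℕ} (m : Fin r → ℕ)

/-- The factors of the fusion product: `m i` copies of the `i`-th exterior power. -/
abbrev Factor : Type := Σ i : Fin r, Fin (m i)

/-- The exterior degree of a factor. -/
abbrev factorDegree (j : Factor m) : ℕ := (j.1 : ℕ) + 1

/-- Pairwise distinct evaluation points. -/
def factorPoint (j : Factor m) : ℂ := ((Fintype.equivFin (Factor m) j : ℕ) : ℂ)

theorem factorPoint_injective : Function.Injective (factorPoint m) := by
  intro a b h
  exact (Fintype.equivFin (Factor m)).injective (Fin.ext (Nat.cast_injective h))

theorem factorDegree_le (j : Factor m) : factorDegree m j ≤ r + 1 := by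
  have := j.1.2
  simp only [factorDegree]
  omega

/-- The product of the highest weight vectors. -/
abbrev fusionGen : DefRing r (factorDegree m) :=
  minorProd ℂ[X] (stdColumns (factorDegree_le m))

variable {m}

theorem apply_eq_zero_of_mem_nPlus {x : g r} (hx : x ∈ nPlus r) {p q : Fin (r + 1)}
    (h : q ≤ p) : (x : Matrix (Fin (r + 1)) (Fin (r + 1)) ℂ) p q = 0 := by
  induction hx using Submodule.span_induction with
  | mem x hx =>
    obtain ⟨a, b, hab, rfl⟩ := hx
    simp only [E, LieAlgebra.SpecialLinear.val_single]
    refine Matrix.single_apply_of_ne _ _ _ _ _ ?_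
    rintro ⟨rfl, rfl⟩
    exact absurd hab (not_lt.2 h)
  | zero => rfl
  | add x y _ _ hx hy =>
    change (x : Matrix (Fin (r + 1)) (Fin (r + 1)) ℂ) p q +
      (y : Matrix (Fin (r + 1)) (Fin (r + 1)) ℂ) p q = 0
    rw [hx, hy, add_zero]
  | smul c x _ hx =>
    change c • (x : Matrix (Fin (r + 1)) (Fin (r + 1)) ℂ) p q = 0
    rw [hx, smul_zero]

theorem envAction_cur_fusionGen (f : ℂ[X]) (x : g r)
    (hx : ∀ p q, q < p → (x : Matrix (Fin (r + 1)) (Fin (r + 1)) ℂ) p q = 0) :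
    envAction (factorDegree m) (factorPoint m) r (cur f x) (fusionGen m) =
      (∑ j : Factor m, ∑ b : Fin (factorDegree m j),
        f.comp (Polynomial.C (factorPoint m j) * Polynomial.X) *
        Polynomial.C ((x : Matrix (Fin (r + 1)) (Fin (r + 1)) ℂ)
          (stdColumns (factorDegree_le m) j b) (stdColumns (factorDegree_le m) j b))) •
        fusionGen m := by
  rw [envAction_cur, der_minorProd_stdColumns]
  · rfl
  · intro j p q h
    rw [evalPoints_tmul, Matrix.smul_apply, Matrix.map_apply, hx p q h, map_zero, smul_zero]

theorem sum_stdColumns (j : Factor m) (f : Fin (r + 1) → ℂ) :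
    ∑ b : Fin (factorDegree m j), f (stdColumns (factorDegree_le m) j b) =
      ∑ p : Fin (r + 1) with p ≤ j.1.castSucc, f p := by
  refine Finset.sum_bij (fun b _ => stdColumns (factorDegree_le m) j b) ?_ ?_ ?_ ?_
  · intro b _
    have := b.2
    simp only [factorDegree] at this
    simp only [Finset.mem_filter, Finset.mem_univ, true_and, Fin.le_def, Fin.val_castSucc,
      stdColumns, Fin.val_castLE]
    omega
  · intro a _ b _ h
    exact Fin.castLE_injective _ h
  · intro p hp
    simp only [Finset.mem_filter, Finset.mem_univ, true_and, Fin.le_def, Fin.val_castSucc] at hp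
    exact ⟨⟨p, Nat.lt_succ_of_le hp⟩, Finset.mem_univ _, rfl⟩
  · intro _ _
    rfl

theorem sum_stdColumns_eq_weight (h : cartan r) :
    ∑ j : Factor m, ∑ b : Fin (factorDegree m j),
      ((h : g r) : Matrix (Fin (r + 1)) (Fin (r + 1)) ℂ)
        (stdColumns (factorDegree_le m) j b) (stdColumns (factorDegree_le m) j b) =
      weight m h := by
  have h1 : ∀ j : Factor m, ∑ b : Fin (factorDegree m j),
      ((h : g r) : Matrix (Fin (r + 1)) (Fin (r + 1)) ℂ)
        (stdColumns (factorDegree_le m) j b) (stdColumns (factorDegree_le m) j b) =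
      fundamentalWeight r j.1 h :=
    fun j => sum_stdColumns j fun p => ((h : g r) : Matrix (Fin (r + 1)) (Fin (r + 1)) ℂ) p p
  rw [Finset.sum_congr rfl fun j _ => h1 j, Fintype.sum_sigma]
  simp [weight]

theorem lowering_fusionGen (i : Fin r) :
    envAction (factorDegree m) (factorPoint m) r (cur 1 (xMinus r i) ^ (m i + 1)) (fusionGen m) =
      0 := by
  have hF : evalPoints (factorPoint m) r (1 ⊗ₜ xMinus r i) =
      fun _ => Matrix.single i.succ i.castSucc 1 := by
    funext j
    rw [evalPoints_tmul]
    simp [xMinus, E]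
  set D : Derivation ℂ[X] (DefRing r (factorDegree m)) (DefRing r (factorDegree m)) :=
    der (fun _ => Matrix.single i.succ i.castSucc 1) with hD
  have hcur : envAction (factorDegree m) (factorPoint m) r (cur 1 (xMinus r i)) =
      (D : DefRing r (factorDegree m) →ₗ[ℂ[X]] DefRing r (factorDegree m)) := by
    refine LinearMap.ext fun q => ?_
    rw [envAction_cur, hF]
    rfl
  rw [map_pow, hcur]
  -- The lowering operator has square zero on the `m i` minors of size `i + 1` and kills all the
  -- others, so the nilpotency orders add up to `m i`.
  have hN : ∑ j : Factor m, (if j.1 = i then 1 else 0) = m i := by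
    rw [Fintype.sum_sigma, Finset.sum_eq_single i]
    · simp
    · intro l _ hl
      simp [hl]
    · exact fun h => absurd (Finset.mem_univ _) h
  rw [← hN]
  refine der_pow_prod_eq_zero D Finset.univ _ _ fun j _ => ?_
  split_ifs with hj
  · rw [pow_succ, pow_one, mul_smul]
    exact der_single_der_single_minor_eq_zero (ne_of_gt Fin.castSucc_lt_succ) j _
      (Fin.castLE_injective (factorDegree_le m j))
  · rw [zero_add, pow_one]
    refine der_single_minor_eq_zero _ _ j _ fun b hb => ?_
    have hb' : (b : ℕ) = i := congrArg Fin.val hb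
    have h1 := b.2
    have h2 : (j.1 : ℕ) ≠ i := fun e => hj (Fin.ext e)
    simp only [factorDegree] at h1
    -- A minor of another size that contains column `i` also contains column `i + 1`, so the
    -- replacement repeats a column.
    refine ⟨⟨i + 1, by simp only [factorDegree]; omega⟩, fun e => ?_, rfl⟩
    have := congrArg Fin.val e
    simp only at this
    omega

theorem relator_fusionGen {u : UCurrent r} (hu : Relator m u) :
    ∃ q ∈ lattice (factorDegree m) (factorPoint m) (fusionGen m),
      envAction (factorDegree m) (factorPoint m) r u (fusionGen m) = (Polynomial.X : ℂ[X]) • q := by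
  have hdiag : ∀ (h : cartan r) (p q : Fin (r + 1)), q < p →
      ((h : g r) : Matrix (Fin (r + 1)) (Fin (r + 1)) ℂ) p q = 0 := fun h p q hpq =>
    h.2 hpq.ne'
  cases hu with
  | raising f x hx =>
    refine ⟨0, zero_mem _, ?_⟩
    rw [envAction_cur_fusionGen f x fun p q h => apply_eq_zero_of_mem_nPlus hx h.le]
    simp [apply_eq_zero_of_mem_nPlus hx le_rfl]
  | cartanPos f h =>
    rw [envAction_cur_fusionGen _ _ (hdiag h)]
    -- The polynomial `t f`, evaluated at `ε z_j`, has the factor `ε`; the witness is the remaining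
    -- scalar times the generator.
    refine ⟨_, Submodule.smul_mem _ (∑ j : Factor m, ∑ b : Fin (factorDegree m j),
      Polynomial.C (factorPoint m j) *
        f.comp (Polynomial.C (factorPoint m j) * Polynomial.X) *
        Polynomial.C (((h : g r) : Matrix (Fin (r + 1)) (Fin (r + 1)) ℂ)
          (stdColumns (factorDegree_le m) j b) (stdColumns (factorDegree_le m) j b)))
      (self_mem_lattice _), ?_⟩
    rw [smul_smul, Finset.mul_sum]
    congr 1
    refine Finset.sum_congr rfl fun j _ => ?_
    rw [Finset.mul_sum]
    refine Finset.sum_congr rfl fun b _ => ?_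
    rw [Polynomial.mul_comp, Polynomial.X_comp]
    ring
  | cartanZero h =>
    refine ⟨0, zero_mem _, ?_⟩
    rw [map_sub, LinearMap.sub_apply, envAction_cur_fusionGen _ _ (hdiag h), AlgHom.commutes,
      smul_zero, sub_eq_zero, ← sum_stdColumns_eq_weight]
    simp only [Polynomial.one_comp, one_mul, ← map_sum]
    exact algebraMap_smul ℂ[X] _ (fusionGen m)
  | lowering i =>
    exact ⟨0, zero_mem _, by rw [lowering_fusionGen, smul_zero]⟩

variable (m)

theorem card_columnSets_factorDegree :
    Fintype.card (ColumnSets (factorDegree m) (r + 1)) =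
      ∏ i : Fin r, (r + 1).choose ((i : ℕ) + 1) ^ m i := by
  rw [Fintype.card_pi]
  have h : ∀ j : Factor m, Fintype.card {s : Finset (Fin (r + 1)) // s.card = factorDegree m j} =
      (r + 1).choose ((j.1 : ℕ) + 1) := fun j => by rw [Fintype.card_finset_len, Fintype.card_fin]
  rw [Finset.prod_congr rfl fun j _ => h j, Fintype.prod_sigma]
  simp

theorem finiteDimensional_weylModule : FiniteDimensional ℂ (WeylModule m) := by
  rw [FiniteDimensional, ← Module.rank_lt_aleph0_iff]
  exact (rank_weylModule_le m).trans_lt (Cardinal.natCast_lt_aleph0)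

theorem finrank_weylModule :
    Module.finrank ℂ (WeylModule m) = ∏ i : Fin r, (r + 1).choose ((i : ℕ) + 1) ^ m i := by
  have := finiteDimensional_weylModule m
  refine le_antisymm (Module.finrank_le_of_rank_le (rank_weylModule_le m)) ?_
  rw [← card_columnSets_factorDegree]
  exact card_le_finrank (fusionGen m) (fun _ hu => relator_fusionGen hu)
    (exists_X_pow_smul_minorProd_columns (factorPoint_injective m) (factorDegree_le m))

end LowerBound

end CurrentWeyl

end

theorem theorem1p4p1 (r : ℕ) (m : Fin r → ℕ) :
    FiniteDimensional ℂ (CurrentWeyl.WeylModule m) ∧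
      Module.finrank ℂ (CurrentWeyl.WeylModule m) =
        ∏ i : Fin r, (r + 1).choose ((i : ℕ) + 1) ^ m i := by
  exact ⟨CurrentWeyl.finiteDimensional_weylModule m, CurrentWeyl.finrank_weylModule m⟩
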